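/- Let $R$ be a commutative ring and $q,y\in R$. Write $[n]_q=1+q+\dots+q^{n-1}$, and define the $q$-Laguerre polynomials $L_n=L_n(x;q,y)\in R[x]$ by $L_0=1$, $L_1=x-y$ and $$L_{n+1}=(x-y[n+1]_q-[n]_q)L_n-y[n]_q^2L_{n-1}\qquad(n\ge 1).$$ There is exactly one $R$-linear functional $\mathcal L:R[x]\to R$ with $\mathcal L(1)=1$ and $\mathcal L(L_mL_n)=0$ for all $m\neq n$. Let $n_1,\dots,n_k$ be positive integers, $N=n_1+\dots+n_k$, $[N]=\{1,\dots,N\}$, and split $[N]$ into the consecutive intervals $I_1,\dots,I_k$ with $|I_r|=n_r$. For a permutation $\sigma$ of $[N]$ (or of any $[s]$) let $\mathrm{wex}(\sigma)=\#\{i:\sigma(i)\ge i\}$ and $$\mathrm{cr}(\sigma)=\#\{(i,j): i<j\le\sigma(i)<\sigma(j)\ \text{or}\ \sigma(i)<\sigma(j)<i<j\}.$$ An $(n_1,\dots,n_k)$-derangement is a permutation $\sigma$ of $[N]$ for which no $i$ has $i$ and $\sigma(i)$ in the same $I_r$. **Matchings.** A matching of degree $N$ is a set of edges $(i,j)\in[N]\times[N]$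 ($i$ the upper, $j$ the lower endpoint), no two distinct ones of which share an upper or share a lower endpoint; if it has $N$ edges it is perfect and is identified with a permutation $\pi$ of $[N]$, with edges $e_i=(i,\pi(i))$. In a matching $\rho$, the block difference of an edge $(i,j)$ is the number of unmatched lower vertices $<j$ minus the number of unmatched upper vertices $<i$. Let $\mathrm{bwex}(\rho)$ be the number of edges of block difference $\ge 0$, let $\mathrm{bwt}(\rho)$ be the sum of $d$ over the edges of block difference $d\ge0$ plus the sum of $-d-1$ over those of block difference $d<0$, and let $\mathrm{cross}(\rho)$ be the number of pairs of edges $(i,j),(i',j')$ with $i<i'$ and $j>j'$. For a permutation $\pi$ let $\mathrm{wt}(\pi)=\sum_{\pi(i)\ge i}(\pi(i)-i)+\sum_{\pi(i)<i}(i-\pi(i)-1)$. **Marked perfect matchings.** An edge $(i,j)$ is homogeneous if $i,j$ lie in the same $I_r$. A marked perfect matching is a pair $\mathfrak m=(\pi,S)$ of a perfect matching $\pi$ of degree $N$ and a set $S$ of its edges (the marked edges) that contains all inhomogeneous edges. Let $\pi\setminus S$ be the matching of degree $N$ obtained by deleting the marked edges but no vertices, and $\pi|_S$ the perfect matching of degree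 $|S|$ obtained by deleting the unmarked edges with their endpoints and renumbering increasingly. Let $e(\mathfrak m)$ be the number of edges of $\pi\setminus S$ and $$\mathrm{bwex}(\mathfrak m)=\mathrm{bwex}(\pi\setminus S)+\mathrm{wex}(\pi|_S),\quad \mathrm{wt}(\mathfrak m)=\mathrm{bwt}(\pi\setminus S)+\mathrm{wt}(\pi|_S),\quad \mathrm{cross}(\mathfrak m)=\mathrm{cross}(\pi\setminus S)-\mathrm{cross}(\pi|_S).$$ Derangements $\sigma$ are identified with the marked perfect matchings all of whose edges are inhomogeneous; let $\mathcal D$ be the set of these. **The map $\Phi$.** The block difference $\mathrm{bdiff}_{\mathfrak m}(e_i)$ is the number of marked edges with lower endpoint $<\pi(i)$ minus the number of marked edges with upper endpoint $<i$. The edge $e_j$ crosses $e_i$ from the left if $j<i$ and $\pi(j)>\pi(i)$, and from the right if $j>i$ and $\pi(j)<\pi(i)$. A homogeneous edge $e$ is convertible in $\mathfrak m$ if every edge $e'$ crossing $e$ from the left has $\mathrm{bdiff}_{\mathfrak m}(e')\ge0$ and every edge $e'$ crossing $e$ from the right has $\mathrm{bdiff}_{\mathfrak m}(e')\le-1$,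 where both inequalities have to be strict if $e$ is marked. Define $\Phi(\mathfrak m)$ as follows. If no edge is homogeneous, $\Phi(\mathfrak m)=\mathfrak m$. If there are homogeneous edges and all of them have block difference $\ge0$, toggle the mark of the homogeneous edge with the smallest lower endpoint. Otherwise let $i$ be minimal such that $e_i$ is homogeneous with negative block difference; if $e_i$ is convertible, toggle its mark; if not, toggle the mark of $e_{i'}$, where $i'$ is the largest $j<i$ such that $e_j$ is homogeneous, has block difference $0$ and crosses $e_i$. **Theorem.** 1. The linearization coefficient of the $q$-Laguerre polynomials is $$\mathcal L(L_{n_1}\cdots L_{n_k})=\sum_{\sigma}y^{\mathrm{wex}(\sigma)}q^{\mathrm{cr}(\sigma)},$$ where $\sigma$ runs over the $(n_1,\dots,n_k)$-derangements. 2. Every marked perfect matching satisfies $\mathrm{wt}(\mathfrak m)+\mathrm{cross}(\mathfrak m)\ge0$, and $$\mathcal L(L_{n_1}\cdots L_{n_k})=\sum_{\mathfrak m\in\mathcal D}y^{\mathrm{bwex}(\mathfrak m)}q^{\mathrm{wt}(\mathfrak m)+\mathrm{cross}(\mathfrak m)}.$$ 3. The map $\Phi$ is a well-defined involution on the marked perfect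 matchings, and its fixed points are exactly the elements of $\mathcal D$. For $\mathfrak m=(\pi,S)\notin\mathcal D$ there is a homogeneous edge $e$, convertible in $\mathfrak m$, with $\Phi(\mathfrak m)=(\pi,S\,\triangle\,\{e\})$, and $(-1)^{e(\Phi(\mathfrak m))}=-(-1)^{e(\mathfrak m)}$. For all $\mathfrak m$, $\mathrm{bwex}(\Phi(\mathfrak m))=\mathrm{bwex}(\mathfrak m)$ and $\mathrm{wt}(\Phi(\mathfrak m))+\mathrm{cross}(\Phi(\mathfrak m))=\mathrm{wt}(\mathfrak m)+\mathrm{cross}(\mathfrak m)$. -/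

import Mathlib

open Polynomial Finset

namespace QLaguerre

/-! ### The `q`-Laguerre polynomials and their linear functional -/

/-- `[n]_q = 1 + q + ⋯ + q^(n-1)`. -/
def qNum {R : Type*} [CommRing R] (q : R) (n : ℕ) : R := ∑ i ∈ range n, q ^ i

/-- The `q`-Laguerre polynomials `L_n(x; q, y)`, by their three-term recurrence. -/
noncomputable def qLaguerre {R : Type*} [CommRing R] (q y : R) : ℕ → R[X]
  | 0 => 1
  | 1 => X - C y
  | n + 2 => (X - C (y * qNum q (n + 2)) - C (qNum q (n + 1))) * qLaguerre q y (n + 1)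
      - C (y * qNum q (n + 1) ^ 2) * qLaguerre q y n

/-- `𝓛` is the (normalized) linear functional with respect to which the `q`-Laguerre
polynomials are orthogonal. -/
structure IsLaguerreFunctional {R : Type*} [CommRing R] (q y : R) (𝓛 : R[X] →ₗ[R] R) : Prop where
  map_one : 𝓛 1 = 1
  orthogonal : ∀ m n : ℕ, m ≠ n → 𝓛 (qLaguerre q y m * qLaguerre q y n) = 0

/-! ### Statistics on permutations -/

/-- Number of weak excedances: `i` with `σ(i) ≥ i`. -/
def wex {N : ℕ} (σ : Equiv.Perm (Fin N)) : ℕ := #{i : Fin N | i ≤ σ i}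

/-- Number of crossings of a permutation: pairs `(i, j)` with
`i < j ≤ σ(i) < σ(j)` or `σ(i) < σ(j) < i < j`. -/
def cr {N : ℕ} (σ : Equiv.Perm (Fin N)) : ℕ :=
  #{p : Fin N × Fin N | (p.1 < p.2 ∧ p.2 ≤ σ p.1 ∧ σ p.1 < σ p.2) ∨
    (σ p.1 < σ p.2 ∧ σ p.2 < p.1 ∧ p.1 < p.2)}

/-- The weight of a block difference, or of `σ(i) - i`: `d` if `d ≥ 0`, and `-d - 1` if `d < 0`. -/
def diffWeight (d : ℤ) : ℤ := if 0 ≤ d then d else -d - 1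

/-- The weight of a permutation (perfect matching):
`∑_{σ(i) ≥ i} (σ(i) - i) + ∑_{σ(i) < i} (i - σ(i) - 1)`. -/
def permWt {N : ℕ} (σ : Equiv.Perm (Fin N)) : ℤ :=
  ∑ i : Fin N, diffWeight (((σ i : ℕ) : ℤ) - ((i : ℕ) : ℤ))

/-! ### Matchings of the complete bipartite graph `K_{N,N}` -/

/-- A matching of degree `N`: a set of edges `(upper vertex, lower vertex)` of `K_{N,N}`, no two
distinct ones of which share a vertex. -/
structure Matching (N : ℕ) where
  edges : Finset (Fin N × Fin N)
  eq_of_upper : ∀ e ∈ edges, ∀ f ∈ edges, e.1 = f.1 → e = f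
  eq_of_lower : ∀ e ∈ edges, ∀ f ∈ edges, e.2 = f.2 → e = f

namespace Matching

variable {N : ℕ}

/-- Upper block index of `i`: one more than the number of unmatched upper vertices before `i`. -/
def bindU (π : Matching N) (i : Fin N) : ℕ := #{j : Fin N | j < i ∧ ∀ e ∈ π.edges, e.1 ≠ j} + 1

/-- Lower block index of `i`: one more than the number of unmatched lower vertices before `i`. -/
def bindL (π : Matching N) (i : Fin N) : ℕ := #{j : Fin N | j < i ∧ ∀ e ∈ π.edges, e.2 ≠ j} + 1

/-- The block difference of an edge. -/
def bdiff (π : Matching N) (e : Fin N × Fin N) : ℤ := (π.bindL e.2 : ℤ) - (π.bindU e.1 : ℤ)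

/-- The number of block weak excedances. -/
def bwex (π : Matching N) : ℕ := #{e ∈ π.edges | 0 ≤ π.bdiff e}

/-- The block weight. -/
def bwt (π : Matching N) : ℤ := ∑ e ∈ π.edges, diffWeight (π.bdiff e)

/-- The number of crossings of a matching: pairs of edges `((i, π(i)), (j, π(j)))` with
`i < j` and `π(i) > π(j)`. -/
def cross (π : Matching N) : ℕ := #{p ∈ π.edges ×ˢ π.edges | p.1.1 < p.2.1 ∧ p.2.2 < p.1.2}

/-- The edges of the bijection `σ` with upper endpoint in the set `T`. In particular, for `T` the
set of all vertices this is the perfect matching identified with the permutation `σ`. -/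
def ofPerm (σ : Equiv.Perm (Fin N)) (T : Finset (Fin N)) : Matching N where
  edges := T.image fun i => (i, σ i)
  eq_of_upper := by
    simp only [mem_image]
    rintro _ ⟨i, _, rfl⟩ _ ⟨j, _, rfl⟩ h
    simp only at h
    rw [h]
  eq_of_lower := by
    simp only [mem_image]
    rintro _ ⟨i, _, rfl⟩ _ ⟨j, _, rfl⟩ h
    rw [σ.injective h]

end Matching

/-! ### Homogeneous edges and derangements -/

/-- Vertex `i` (counted from `0`) lies in the `r`-th of the consecutive intervals of lengths
`n 0, n 1, …`. -/
def InInterval {k : ℕ} (n : Fin k → ℕ) (r : Fin k) (i : Fin (∑ s, n s)) : Prop :=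
  ∑ s ∈ Finset.Iio r, n s ≤ (i : ℕ) ∧ (i : ℕ) < ∑ s ∈ Finset.Iic r, n s

instance {k : ℕ} (n : Fin k → ℕ) (r : Fin k) (i : Fin (∑ s, n s)) :
    Decidable (InInterval n r i) := by
  unfold InInterval; infer_instance

/-- The edge from upper vertex `i` to lower vertex `j` is homogeneous: both endpoints lie in the
same interval. -/
def Homogeneous {k : ℕ} (n : Fin k → ℕ) (i j : Fin (∑ s, n s)) : Prop :=
  ∃ r : Fin k, InInterval n r i ∧ InInterval n r j

instance {k : ℕ} (n : Fin k → ℕ) (i j : Fin (∑ s, n s)) : Decidable (Homogeneous n i j) := by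
  unfold Homogeneous; infer_instance

/-- `σ` is an `(n_1, …, n_k)`-derangement. -/
def IsDerangement {k : ℕ} (n : Fin k → ℕ) (σ : Equiv.Perm (Fin (∑ s, n s))) : Prop :=
  ∀ i, ¬ Homogeneous n i (σ i)

instance {k : ℕ} (n : Fin k → ℕ) (σ : Equiv.Perm (Fin (∑ s, n s))) :
    Decidable (IsDerangement n σ) := by
  unfold IsDerangement; infer_instance

/-! ### Marked perfect matchings -/

/-- Marked perfect matchings: pairs `(π, S)` of a perfect matching `π` of degree `∑ n_s`, given as
a permutation, and a set `S` of marked edges containing all inhomogeneous edges. The edge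
`e_i = (i, π(i))` is represented by its upper endpoint `i`. -/
abbrev MarkedPM {k : ℕ} (n : Fin k → ℕ) : Type :=
  {m : Equiv.Perm (Fin (∑ s, n s)) × Finset (Fin (∑ s, n s)) //
    ∀ i, ¬ Homogeneous n i (m.1 i) → i ∈ m.2}

namespace MarkedPM

variable {k : ℕ} {n : Fin k → ℕ}

/-- The underlying perfect matching. -/
abbrev perm (m : MarkedPM n) : Equiv.Perm (Fin (∑ s, n s)) := m.1.1

/-- The set of marked edges. -/
abbrev marked (m : MarkedPM n) : Finset (Fin (∑ s, n s)) := m.1.2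

/-- The edge `e_i` is homogeneous. -/
abbrev Hom (m : MarkedPM n) (i : Fin (∑ s, n s)) : Prop := Homogeneous n i (m.perm i)

/-- The unmarked portion `π ∖ S`: delete the marked edges and keep all vertices. -/
def unmarkedPortion (m : MarkedPM n) : Matching (∑ s, n s) := Matching.ofPerm m.perm m.markedᶜ

/-- The marked portion `π|_S`: delete the unmarked edges together with their endpoints, and
renumber the remaining `|S|` upper and `|S|` lower vertices increasingly. -/
def markedPortion (m : MarkedPM n) : Equiv.Perm (Fin (#m.marked)) :=
  ((m.marked.orderIsoOfFin rfl).toEquiv.trans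
    (m.perm.subtypeEquiv (q := fun j => j ∈ m.marked.map m.perm.toEmbedding)
      (fun i => by simp))).trans
    ((m.marked.map m.perm.toEmbedding).orderIsoOfFin (card_map _)).toEquiv.symm

/-- Number of edges of the unmarked portion. -/
def numEdges (m : MarkedPM n) : ℕ := #m.unmarkedPortion.edges

/-- `bwex(m) = bwex(π ∖ S) + wex(π|_S)`. -/
def bwex (m : MarkedPM n) : ℕ := m.unmarkedPortion.bwex + wex m.markedPortion

/-- `cross(m) = cross(π ∖ S) - cross(π|_S)`. -/
def cross (m : MarkedPM n) : ℤ :=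
  (m.unmarkedPortion.cross : ℤ) - ((Matching.ofPerm m.markedPortion univ).cross : ℤ)

/-- `wt(m) = bwt(π ∖ S) + wt(π|_S)`. -/
def wt (m : MarkedPM n) : ℤ := m.unmarkedPortion.bwt + permWt m.markedPortion

/-- The marked perfect matchings identified with the derangements: no edge is homogeneous. -/
def IsDerangement (m : MarkedPM n) : Prop := ∀ i, ¬ m.Hom i

instance (m : MarkedPM n) : Decidable m.IsDerangement := by
  unfold IsDerangement; infer_instance

/-! ### The involution -/

/-- Upper block index in `m`: one more than the number of upper endpoints of marked edges
before `i`. -/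
def bindU (m : MarkedPM n) (i : Fin (∑ s, n s)) : ℕ := #{j ∈ m.marked | j < i} + 1

/-- Lower block index in `m`: one more than the number of lower endpoints of marked edges
before the lower vertex `l`. -/
def bindL (m : MarkedPM n) (l : Fin (∑ s, n s)) : ℕ := #{j ∈ m.marked | m.perm j < l} + 1

/-- Block difference in `m` of the edge `e_i = (i, π(i))`. -/
def bdiff (m : MarkedPM n) (i : Fin (∑ s, n s)) : ℤ := (m.bindL (m.perm i) : ℤ) - (m.bindU i : ℤ)

/-- The edge `e_j` crosses the edge `e_i` from the left. -/
abbrev CrossesLeft (m : MarkedPM n) (j i : Fin (∑ s, n s)) : Prop :=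
  j < i ∧ m.perm i < m.perm j

/-- The edge `e_j` crosses the edge `e_i` from the right. -/
abbrev CrossesRight (m : MarkedPM n) (j i : Fin (∑ s, n s)) : Prop :=
  i < j ∧ m.perm j < m.perm i

/-- The homogeneous edge `e_i` is convertible in `m`. -/
def Convertible (m : MarkedPM n) (i : Fin (∑ s, n s)) : Prop :=
  m.Hom i ∧
  (i ∉ m.marked → ∀ j, m.CrossesLeft j i ∨ m.CrossesRight j i →
    (m.CrossesLeft j i ∧ 0 ≤ m.bdiff j) ∨ (m.CrossesRight j i ∧ m.bdiff j ≤ -1)) ∧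
  (i ∈ m.marked → ∀ j, m.CrossesLeft j i ∨ m.CrossesRight j i →
    (m.CrossesLeft j i ∧ 0 < m.bdiff j) ∨ (m.CrossesRight j i ∧ m.bdiff j < -1))

set_option synthInstance.maxSize 1000 in
set_option synthInstance.maxHeartbeats 200000 in
instance (m : MarkedPM n) (i : Fin (∑ s, n s)) : Decidable (m.Convertible i) := by
  unfold Convertible; infer_instance

/-- Mark the homogeneous edge `e_i` if it is unmarked, and unmark it if it is marked. -/
def toggle (m : MarkedPM n) (i : Fin (∑ s, n s)) (hi : m.Hom i) : MarkedPM n :=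
  ⟨(m.perm, symmDiff m.marked {i}), fun j hj => by
    have h1 : j ∈ m.marked := m.2 j hj
    have h2 : j ≠ i := fun h => hj (h ▸ hi)
    simp [mem_symmDiff, h1, h2]⟩

/-- The lower endpoints of the homogeneous edges. -/
def homLower (m : MarkedPM n) : Finset (Fin (∑ s, n s)) :=
  {l | m.Hom (m.perm.symm l)}

/-- The homogeneous edges with negative block difference. -/
def homNeg (m : MarkedPM n) : Finset (Fin (∑ s, n s)) := {i | m.Hom i ∧ m.bdiff i < 0}

/-- The homogeneous edges `e_j` with `j < i` and block difference `0` that cross `e_i`. -/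
def homZero (m : MarkedPM n) (i : Fin (∑ s, n s)) : Finset (Fin (∑ s, n s)) :=
  {j | j < i ∧ m.Hom j ∧ m.bdiff j = 0 ∧ (m.CrossesLeft j i ∨ m.CrossesRight j i)}

/-- The edge toggled by the involution, or `none`.
* If some homogeneous edge has negative block difference, let `e_i` be the one with smallest `i`;
  take `e_i` if it is convertible, and otherwise `e_j` for the largest `j` in `homZero m i`.
* If there are homogeneous edges, and all have nonnegative block difference, take the one with
  the leftmost lower endpoint.
* If there is no homogeneous edge, there is nothing to toggle. -/
def toggled (m : MarkedPM n) : Option {i : Fin (∑ s, n s) // m.Hom i} :=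
  if h : m.homNeg.Nonempty then
    if m.Convertible (m.homNeg.min' h) then
      some ⟨m.homNeg.min' h, (mem_filter.1 (m.homNeg.min'_mem h)).2.1⟩
    else if h' : (m.homZero (m.homNeg.min' h)).Nonempty then
      some ⟨(m.homZero (m.homNeg.min' h)).max' h',
        (mem_filter.1 ((m.homZero (m.homNeg.min' h)).max'_mem h')).2.2.1⟩
    else none
  else if h : m.homLower.Nonempty then
    some ⟨m.perm.symm (m.homLower.min' h), (mem_filter.1 (m.homLower.min'_mem h)).2⟩
  else none

/-- The map `Φ` on marked perfect matchings. -/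
def Phi (m : MarkedPM n) : MarkedPM n :=
  match m.toggled with
  | none => m
  | some i => m.toggle i.1 i.2

end MarkedPM

end QLaguerre

/-!
The linear functional `momentFunctional` is defined by the moments
`𝓛(Xᴺ) = ∑_{σ ∈ S_N} y^wex(σ) q^cr(σ)`, and `matchPoly N` is the signed generating polynomial
`∑_ρ (-1)^|ρ| y^bwex(ρ) q^(bwt(ρ) + cross(ρ)) X^(N - |ρ|)` of the matchings of degree `N`.

A family of matchings of the intervals glues to a matching of `[N]` with homogeneous edges without
changing block differences or crossings, and such a matching together with a permutation of its
unmatched vertices is a marked perfect matching. Since `cr(σ) = wt(σ) - inv(σ)` (`permWt_eq`), this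
makes `𝓛(∏ matchPoly (n s))` the signed sum over all marked perfect matchings
(`momentFunctional_prod_eq_signed`).

In a marked perfect matching, `bwex` and `wt` depend only on the block differences of all edges,
marked or not, and `cross` is the difference of the numbers of unmarked and marked crossings.
Toggling a convertible edge `e` moves the block difference of each edge crossing `e` by one away
from the boundary between `-1` and `0` when `e` gets marked, and back when it gets unmarked. So the
signs of all block differences persist, and the change of `wt` cancels that of `cross`
(`Convertible.wt_add_cross_toggle`). That the edge chosen by `Φ` is convertible, and is chosen again
in the image, rests on the monotonicity of block differences along crossings (`add_ind_le_bdiff`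
and its refinements) and on the fact that inhomogeneous edges never obstruct
(`convertible_of_hom`). Cancelling by `Φ` leaves the sum over derangements
(`momentFunctional_prod`).

For two intervals of different lengths there are no derangements, so the polynomials `matchPoly`
are orthogonal. Over `ℤ[q, y]` their norms do not vanish, so they satisfy a three-term recurrence.
Its coefficients can be read off from the subleading coefficients, given by matchings with one edge,
and the constant coefficients, `(-1)ⁿ yⁿ [n]_q!`. This is the recurrence of the `q`-Laguerre
polynomials, so `matchPoly = qLaguerre` over `ℤ[q, y]`, hence over every commutative ring
(`matchPoly_eq_qLaguerre`), and the functional orthogonalizing them is unique because they are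
monic.
-/

namespace QLaguerre

/-! ### The interval containing a vertex -/

section Blocks

variable {k : ℕ} (n : Fin k → ℕ)

/-- The index of the interval containing a vertex. -/
def blk (i : Fin (∑ s, n s)) : Fin k := (finSigmaFinEquiv.symm i).1

/-- The inclusion of the `r`-th interval. -/
def emb (r : Fin k) (a : Fin (n r)) : Fin (∑ s, n s) := finSigmaFinEquiv ⟨r, a⟩

variable {n}

lemma emb_val (r : Fin k) (a : Fin (n r)) :
    (emb n r a : ℕ) = ∑ s ∈ Finset.Iio r, n s + a := by
  rw [emb, finSigmaFinEquiv_apply]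
  congr 1
  refine Finset.sum_bij (fun i _ => Fin.castLE r.2.le i) ?_ ?_ ?_ ?_
  · intro a _
    simp only [Finset.mem_Iio, Fin.lt_def]
    exact a.2
  · intro a _ b _ h
    simpa [Fin.ext_iff] using h
  · intro b hb
    exact ⟨⟨b, by simpa using hb⟩, by simp, rfl⟩
  · intro _ _
    rfl

@[simp] lemma blk_emb (r : Fin k) (a : Fin (n r)) : blk n (emb n r a) = r := by
  simp [blk, emb]

lemma exists_emb (i : Fin (∑ s, n s)) : ∃ r a, emb n r a = i :=
  ⟨_, _, finSigmaFinEquiv.apply_symm_apply i⟩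

lemma sum_Iic_eq (r : Fin k) : ∑ s ∈ Finset.Iic r, n s = ∑ s ∈ Finset.Iio r, n s + n r := by
  rw [← Finset.Iio_insert, Finset.sum_insert (by simp), add_comm]

lemma emb_lt_of_lt {r s : Fin k} (h : r < s) (a : Fin (n r)) (b : Fin (n s)) :
    emb n r a < emb n s b := by
  rw [Fin.lt_def, emb_val, emb_val]
  have h1 : ∑ t ∈ Finset.Iic r, n t ≤ ∑ t ∈ Finset.Iio s, n t :=
    Finset.sum_le_sum_of_subset fun t ht => by
      simp only [Finset.mem_Iic, Finset.mem_Iio] at *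
      exact ht.trans_lt h
  rw [sum_Iic_eq] at h1
  have := a.2
  omega

@[simp] lemma emb_lt_emb {r : Fin k} {a b : Fin (n r)} : emb n r a < emb n r b ↔ a < b := by
  rw [Fin.lt_def, emb_val, emb_val, Fin.lt_def]
  omega

@[simp] lemma emb_inj {r : Fin k} {a b : Fin (n r)} : emb n r a = emb n r b ↔ a = b := by
  rw [Fin.ext_iff, emb_val, emb_val, Fin.ext_iff]
  omega

lemma blk_mono {i j : Fin (∑ s, n s)} (h : i ≤ j) : blk n i ≤ blk n j := by
  obtain ⟨r, a, rfl⟩ := exists_emb i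
  obtain ⟨s, b, rfl⟩ := exists_emb j
  simp only [blk_emb]
  by_contra! hlt
  exact absurd (emb_lt_of_lt hlt b a) (not_lt.2 h)

lemma inInterval_iff {r : Fin k} {i : Fin (∑ s, n s)} : InInterval n r i ↔ blk n i = r := by
  obtain ⟨s, a, rfl⟩ := exists_emb i
  have hmem : InInterval n s (emb n s a) := by
    refine ⟨?_, ?_⟩
    · rw [emb_val]; omega
    · rw [emb_val, sum_Iic_eq]; have := a.2; omega
  rw [blk_emb]
  refine ⟨fun h => ?_, fun h => h ▸ hmem⟩
  have key : ∀ u v : Fin k, InInterval n u (emb n s a) → InInterval n v (emb n s a) → ¬ u < v := by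
    intro u v hu hv huv
    have h1 : ∑ t ∈ Finset.Iic u, n t ≤ ∑ t ∈ Finset.Iio v, n t :=
      Finset.sum_le_sum_of_subset fun t ht => by
        simp only [Finset.mem_Iic, Finset.mem_Iio] at *
        exact ht.trans_lt huv
    exact absurd (h1.trans hv.1) (not_le.2 hu.2)
  exact le_antisymm (not_lt.1 (key _ _ h hmem)) (not_lt.1 (key _ _ hmem h))

lemma homogeneous_iff {i j : Fin (∑ s, n s)} : Homogeneous n i j ↔ blk n i = blk n j := by
  simp only [Homogeneous, inInterval_iff]
  exact ⟨fun ⟨r, h1, h2⟩ => h1.trans h2.symm, fun h => ⟨_, h, rfl⟩⟩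

end Blocks

/-! ### Ranks and relabelling -/

section Rank

variable {N : ℕ}

/-- The order isomorphism `s ≃ Fin #s` maps an element to the number of smaller elements. -/
lemma orderIsoOfFin_symm_val {s : Finset (Fin N)} {c : ℕ} (h : #s = c) (x : s) :
    (((s.orderIsoOfFin h).symm x : Fin c) : ℕ) = #{j ∈ s | j < x.1} := by
  set r := (s.orderIsoOfFin h).symm x with hr
  have hx : s.orderIsoOfFin h r = x := by simp [hr]
  rw [← Fin.card_Iio r]
  refine Finset.card_bij (fun a _ => (s.orderIsoOfFin h a : Fin N)) ?_ ?_ ?_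
  · intro a ha
    refine mem_filter.2 ⟨(s.orderIsoOfFin h a).2, ?_⟩
    rw [← hx]
    exact (s.orderIsoOfFin h).lt_iff_lt.2 (Finset.mem_Iio.1 ha)
  · intro a _ b _ hab
    exact (s.orderIsoOfFin h).injective (Subtype.ext hab)
  · intro b hb
    obtain ⟨hb1, hb2⟩ := mem_filter.1 hb
    refine ⟨(s.orderIsoOfFin h).symm ⟨b, hb1⟩, ?_, by simp⟩
    rw [Finset.mem_Iio, hr]
    exact (s.orderIsoOfFin h).symm.lt_iff_lt.2 hb2

end Rank

/-- The number of inversions of `σ` among the edges with upper endpoint in `T`. -/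
def invOn {N : ℕ} (σ : Equiv.Perm (Fin N)) (T : Finset (Fin N)) : ℕ :=
  #{p ∈ T ×ˢ T | p.1 < p.2 ∧ σ p.2 < σ p.1}

lemma invOn_insert {N : ℕ} (σ : Equiv.Perm (Fin N)) {T : Finset (Fin N)} {i : Fin N} (hi : i ∉ T) :
    invOn σ (insert i T) =
      invOn σ T + #{j ∈ T | (j < i ∧ σ i < σ j) ∨ (i < j ∧ σ j < σ i)} := by
  have key : ({p ∈ insert i T ×ˢ insert i T | p.1 < p.2 ∧ σ p.2 < σ p.1} : Finset _) =
      {p ∈ T ×ˢ T | p.1 < p.2 ∧ σ p.2 < σ p.1} ∪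
      ({j ∈ T | (j < i ∧ σ i < σ j) ∨ (i < j ∧ σ j < σ i)} : Finset _).image
        (fun j => (min i j, max i j)) := by
    ext ⟨a, b⟩
    simp only [mem_filter, mem_product, mem_union, mem_image, Prod.mk.injEq, mem_insert]
    constructor
    · rintro ⟨⟨rfl | ha, rfl | hb⟩, h1, h2⟩
      · exact absurd h1 (lt_irrefl _)
      · exact Or.inr ⟨b, ⟨hb, Or.inr ⟨h1, h2⟩⟩, min_eq_left h1.le, max_eq_right h1.le⟩
      · exact Or.inr ⟨a, ⟨ha, Or.inl ⟨h1, h2⟩⟩, min_eq_right h1.le, max_eq_left h1.le⟩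
      · exact Or.inl ⟨⟨ha, hb⟩, h1, h2⟩
    · rintro (⟨⟨ha, hb⟩, h⟩ | ⟨j, ⟨hj, h | h⟩, rfl, rfl⟩)
      · exact ⟨⟨Or.inr ha, Or.inr hb⟩, h⟩
      · rw [min_eq_right h.1.le, max_eq_left h.1.le]
        exact ⟨⟨Or.inr hj, Or.inl rfl⟩, h⟩
      · rw [min_eq_left h.1.le, max_eq_right h.1.le]
        exact ⟨⟨Or.inl rfl, Or.inr hj⟩, h⟩
  rw [invOn, key, Finset.card_union_of_disjoint, Finset.card_image_of_injOn]
  · rfl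
  · intro a _ b _ hab
    simp only [Prod.mk.injEq] at hab
    obtain ⟨h1, h2⟩ := hab
    rcases le_total i a with ha | ha <;> rcases le_total i b with hb | hb <;>
      simp_all
  · rw [Finset.disjoint_left]
    rintro ⟨a, b⟩ h1 h2
    simp only [mem_filter, mem_product, mem_image, Prod.mk.injEq] at h1 h2
    obtain ⟨j, ⟨hj, h | h⟩, rfl, rfl⟩ := h2
    · rw [max_eq_left h.1.le] at h1
      exact hi h1.1.2
    · rw [min_eq_left h.1.le] at h1
      exact hi h1.1.1

lemma Matching.cross_ofPerm {N : ℕ} (σ : Equiv.Perm (Fin N)) (T : Finset (Fin N)) :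
    (Matching.ofPerm σ T).cross = invOn σ T := by
  unfold Matching.cross invOn
  refine (Finset.card_bij (fun p _ => ((p.1, σ p.1), (p.2, σ p.2))) ?_ ?_ ?_).symm
  · rintro ⟨a, b⟩ h
    simpa [Matching.ofPerm] using h
  · rintro ⟨a, b⟩ _ ⟨c, d⟩ _ h
    simp only [Prod.mk.injEq] at h
    simp [h.1.1, h.2.1]
  · rintro ⟨⟨a, b⟩, ⟨c, d⟩⟩ h
    simp only [Matching.ofPerm, mem_filter, mem_product, mem_image, Prod.mk.injEq] at h
    obtain ⟨⟨⟨i, hi, rfl, rfl⟩, ⟨j, hj, rfl, rfl⟩⟩, h3⟩ := h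
    exact ⟨(i, j), by simpa using ⟨⟨hi, hj⟩, h3⟩, rfl⟩

namespace MarkedPM

variable {k : ℕ} {n : Fin k → ℕ}

/-! ### The statistics of a marked perfect matching in terms of block differences -/

lemma hom_iff {m : MarkedPM n} {i : Fin (∑ s, n s)} : m.Hom i ↔ blk n i = blk n (m.perm i) :=
  homogeneous_iff

/-- The position of the marked edge `e_i` in the marked portion. -/
def rankU (m : MarkedPM n) (i : Fin (∑ s, n s)) : ℕ := #{j ∈ m.marked | j < i}

/-- The number of marked edges whose lower endpoint is left of that of `e_i`. -/
def rankL (m : MarkedPM n) (i : Fin (∑ s, n s)) : ℕ := #{j ∈ m.marked | m.perm j < m.perm i}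

lemma bdiff_eq (m : MarkedPM n) (i : Fin (∑ s, n s)) :
    m.bdiff i = (m.rankL i : ℤ) - (m.rankU i : ℤ) := by
  simp [bdiff, bindL, bindU, rankL, rankU]

/-- The upper endpoint of the marked edge in position `a`. -/
def markedEdge (m : MarkedPM n) (a : Fin (#m.marked)) : Fin (∑ s, n s) :=
  m.marked.orderEmbOfFin rfl a

lemma markedEdge_mem (m : MarkedPM n) (a : Fin (#m.marked)) : m.markedEdge a ∈ m.marked :=
  Finset.orderEmbOfFin_mem _ _ _

lemma markedEdge_lt_iff (m : MarkedPM n) {a b : Fin (#m.marked)} :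
    m.markedEdge a < m.markedEdge b ↔ a < b :=
  (m.marked.orderEmbOfFin rfl).lt_iff_lt

lemma markedEdge_injective (m : MarkedPM n) : Function.Injective m.markedEdge :=
  (m.marked.orderEmbOfFin rfl).injective

lemma exists_markedEdge (m : MarkedPM n) {i : Fin (∑ s, n s)} (hi : i ∈ m.marked) :
    ∃ a, m.markedEdge a = i := by
  have := Finset.range_orderEmbOfFin m.marked rfl
  have h : i ∈ Set.range (m.marked.orderEmbOfFin rfl) := by rw [this]; exact hi
  exact h

lemma rankU_markedEdge (m : MarkedPM n) (a : Fin (#m.marked)) :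
    m.rankU (m.markedEdge a) = a := by
  have := orderIsoOfFin_symm_val (s := m.marked) rfl ⟨m.markedEdge a, m.markedEdge_mem a⟩
  rw [rankU, ← this]
  congr 1
  rw [OrderIso.symm_apply_eq]
  exact Subtype.ext rfl

lemma markedPortion_val (m : MarkedPM n) (a : Fin (#m.marked)) :
    (m.markedPortion a : ℕ) = m.rankL (m.markedEdge a) := by
  have h : (m.markedPortion a : ℕ) =
      #{j ∈ m.marked.map m.perm.toEmbedding | j < m.perm (m.markedEdge a)} :=
    orderIsoOfFin_symm_val (s := m.marked.map m.perm.toEmbedding) (card_map _)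
      ⟨m.perm (m.markedEdge a), by simpa using m.markedEdge_mem a⟩
  rw [h, rankL, Finset.filter_map, Finset.card_map]
  rfl

lemma rankL_lt_iff (m : MarkedPM n) {i j : Fin (∑ s, n s)} (hi : i ∈ m.marked)
    (hj : j ∈ m.marked) : m.rankL i < m.rankL j ↔ m.perm i < m.perm j := by
  have key : ∀ i j, i ∈ m.marked → m.perm i < m.perm j → m.rankL i < m.rankL j := by
    intro i j hi h
    refine Finset.card_lt_card ⟨fun x hx => ?_, fun hs => ?_⟩
    · simp only [mem_filter] at *
      exact ⟨hx.1, hx.2.trans h⟩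
    · have := hs (mem_filter.2 ⟨hi, h⟩)
      simp at this
  refine ⟨fun h => ?_, key i j hi⟩
  by_contra hn
  rcases (not_lt.1 hn).lt_or_eq with h' | h'
  · exact absurd (key j i hj h') (by omega)
  · rw [m.perm.injective h'] at h
    exact lt_irrefl _ h

lemma markedPortion_lt_iff (m : MarkedPM n) {a b : Fin (#m.marked)} :
    m.markedPortion a < m.markedPortion b ↔
      m.perm (m.markedEdge a) < m.perm (m.markedEdge b) := by
  rw [Fin.lt_def, markedPortion_val, markedPortion_val,
    rankL_lt_iff m (m.markedEdge_mem a) (m.markedEdge_mem b)]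

lemma markedPortion_sub (m : MarkedPM n) (a : Fin (#m.marked)) :
    ((m.markedPortion a : ℕ) : ℤ) - ((a : ℕ) : ℤ) = m.bdiff (m.markedEdge a) := by
  rw [markedPortion_val, bdiff_eq, rankU_markedEdge]

/-- The marked portion realizes the block differences of the marked edges. -/
lemma wex_markedPortion (m : MarkedPM n) :
    wex m.markedPortion = #{i ∈ m.marked | 0 ≤ m.bdiff i} := by
  have hle : ∀ a, a ≤ m.markedPortion a ↔ 0 ≤ m.bdiff (m.markedEdge a) := by
    intro a
    rw [← markedPortion_sub, Fin.le_def]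
    omega
  refine Finset.card_bij (fun a _ => m.markedEdge a) ?_ ?_ ?_
  · intro a ha
    simp only [mem_filter, mem_univ, true_and] at *
    exact ⟨m.markedEdge_mem a, (hle a).1 ha⟩
  · intro a _ b _ h
    exact m.markedEdge_injective h
  · intro i hi
    obtain ⟨h1, h2⟩ := mem_filter.1 hi
    obtain ⟨a, rfl⟩ := m.exists_markedEdge h1
    exact ⟨a, by simpa [hle] using h2, rfl⟩

lemma permWt_markedPortion (m : MarkedPM n) :
    permWt m.markedPortion = ∑ i ∈ m.marked, diffWeight (m.bdiff i) := by
  refine Finset.sum_bij (fun a _ => m.markedEdge a) ?_ ?_ ?_ ?_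
  · intro a _
    exact m.markedEdge_mem a
  · intro a _ b _ h
    exact m.markedEdge_injective h
  · intro i hi
    obtain ⟨a, rfl⟩ := m.exists_markedEdge hi
    exact ⟨a, mem_univ _, rfl⟩
  · intro a _
    rw [markedPortion_sub]

lemma invOn_markedPortion (m : MarkedPM n) :
    invOn m.markedPortion univ = invOn m.perm m.marked := by
  refine Finset.card_bij (fun p _ => (m.markedEdge p.1, m.markedEdge p.2)) ?_ ?_ ?_
  · intro p hp
    simp only [mem_filter, mem_product, mem_univ, true_and, markedPortion_lt_iff] at *
    exact ⟨⟨m.markedEdge_mem _, m.markedEdge_mem _⟩, m.markedEdge_lt_iff.2 hp.1, hp.2⟩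
  · rintro ⟨a, b⟩ _ ⟨c, d⟩ _ h
    simp only [Prod.mk.injEq] at h
    rw [m.markedEdge_injective h.1, m.markedEdge_injective h.2]
  · rintro ⟨i, j⟩ h
    simp only [mem_filter, mem_product] at h
    obtain ⟨⟨hi, hj⟩, h1, h2⟩ := h
    obtain ⟨a, rfl⟩ := m.exists_markedEdge hi
    obtain ⟨b, rfl⟩ := m.exists_markedEdge hj
    refine ⟨(a, b), ?_, rfl⟩
    simp only [mem_filter, mem_product, mem_univ, true_and, markedPortion_lt_iff]
    exact ⟨m.markedEdge_lt_iff.1 h1, h2⟩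

/-- The map sending an upper vertex `i` to the edge `e_i`. -/
def edgeEmb (m : MarkedPM n) : Fin (∑ s, n s) ↪ Fin (∑ s, n s) × Fin (∑ s, n s) :=
  ⟨fun i => (i, m.perm i), fun _ _ h => (Prod.mk.inj h).1⟩

lemma edgeEmb_apply (m : MarkedPM n) (i : Fin (∑ s, n s)) : m.edgeEmb i = (i, m.perm i) := rfl

lemma unmarkedPortion_edges (m : MarkedPM n) :
    m.unmarkedPortion.edges = m.markedᶜ.map m.edgeEmb := by
  rw [unmarkedPortion, Matching.ofPerm, Finset.map_eq_image]
  rfl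

lemma mem_unmarkedPortion_edges (m : MarkedPM n) (e : Fin (∑ s, n s) × Fin (∑ s, n s)) :
    e ∈ m.unmarkedPortion.edges ↔ e.1 ∉ m.marked ∧ m.perm e.1 = e.2 := by
  obtain ⟨a, b⟩ := e
  simp [unmarkedPortion, Matching.ofPerm]

lemma bindU_unmarkedPortion (m : MarkedPM n) (i : Fin (∑ s, n s)) :
    m.unmarkedPortion.bindU i = m.bindU i := by
  rw [Matching.bindU, bindU]
  congr 2
  ext j
  simp only [mem_filter, mem_univ, true_and, mem_unmarkedPortion_edges]
  rw [and_comm]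
  refine and_congr_left fun _ => ⟨fun h => ?_, fun h e he hej => he.1 (hej ▸ h)⟩
  by_contra hj
  exact h (j, m.perm j) ⟨hj, rfl⟩ rfl

lemma bindL_unmarkedPortion (m : MarkedPM n) (l : Fin (∑ s, n s)) :
    m.unmarkedPortion.bindL l = m.bindL l := by
  rw [Matching.bindL, bindL]
  congr 1
  refine (Finset.card_bij (fun j _ => m.perm j) ?_ ?_ ?_).symm
  · intro j hj
    simp only [mem_filter, mem_univ, true_and, mem_unmarkedPortion_edges] at *
    refine ⟨hj.2, fun e he hej => he.1 ?_⟩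
    rw [m.perm.injective (he.2.trans hej)]
    exact hj.1
  · intro a _ b _ h
    exact m.perm.injective h
  · intro j hj
    simp only [mem_filter, mem_univ, true_and, mem_unmarkedPortion_edges] at hj
    refine ⟨m.perm.symm j, ?_, by simp⟩
    simp only [mem_filter, Equiv.apply_symm_apply]
    refine ⟨?_, hj.1⟩
    by_contra h
    exact hj.2 (m.perm.symm j, j) ⟨h, by simp⟩ rfl

lemma bdiff_unmarkedPortion (m : MarkedPM n) (i : Fin (∑ s, n s)) :
    m.unmarkedPortion.bdiff (i, m.perm i) = m.bdiff i := by
  rw [Matching.bdiff, bindU_unmarkedPortion, bindL_unmarkedPortion, bdiff]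

lemma numEdges_eq (m : MarkedPM n) : m.numEdges = #m.markedᶜ := by
  rw [numEdges, unmarkedPortion_edges, card_map]

lemma bwex_eq (m : MarkedPM n) : m.bwex = #{i | 0 ≤ m.bdiff i} := by
  rw [bwex, wex_markedPortion, Matching.bwex, unmarkedPortion_edges, Finset.filter_map, card_map]
  rw [← Finset.card_union_of_disjoint]
  · congr 1
    ext i
    simp only [mem_union, mem_filter, mem_compl, Function.comp_apply, edgeEmb_apply,
      bdiff_unmarkedPortion, mem_univ, true_and]
    tauto
  · exact disjoint_filter_filter (disjoint_compl_left)

lemma wt_eq (m : MarkedPM n) : m.wt = ∑ i, diffWeight (m.bdiff i) := by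
  rw [wt, permWt_markedPortion, Matching.bwt, unmarkedPortion_edges, Finset.sum_map]
  simp only [edgeEmb_apply, bdiff_unmarkedPortion]
  exact Finset.sum_compl_add_sum _ _

lemma cross_eq (m : MarkedPM n) :
    m.cross = (invOn m.perm m.markedᶜ : ℤ) - (invOn m.perm m.marked : ℤ) := by
  rw [cross, Matching.cross_ofPerm, invOn_markedPortion, unmarkedPortion, Matching.cross_ofPerm]

end MarkedPM

namespace MarkedPM

variable {k : ℕ} {n : Fin k → ℕ}

/-! ### Block differences of crossing edges -/

/-- The indicator of the marked edges. -/
def ind (m : MarkedPM n) (i : Fin (∑ s, n s)) : ℤ := if i ∈ m.marked then 1 else 0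

lemma ind_nonneg (m : MarkedPM n) (i : Fin (∑ s, n s)) : 0 ≤ m.ind i := by
  unfold ind; split_ifs <;> simp

lemma ind_of_mem {m : MarkedPM n} {i : Fin (∑ s, n s)} (h : i ∈ m.marked) : m.ind i = 1 :=
  if_pos h

lemma ind_of_notMem {m : MarkedPM n} {i : Fin (∑ s, n s)} (h : i ∉ m.marked) : m.ind i = 0 :=
  if_neg h

lemma bdiff_of_crossesLeft {m : MarkedPM n} {i j : Fin (∑ s, n s)} (h : m.CrossesLeft j i) :
    m.bdiff j = m.bdiff i + #{l ∈ m.marked | m.perm i ≤ m.perm l ∧ m.perm l < m.perm j} +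
      #{l ∈ m.marked | j ≤ l ∧ l < i} := by
  have h1 : m.rankL j = m.rankL i +
      #{l ∈ m.marked | m.perm i ≤ m.perm l ∧ m.perm l < m.perm j} := by
    rw [rankL, rankL, ← Finset.card_union_of_disjoint]
    · congr 1
      ext l
      simp only [mem_filter, mem_union, ← and_or_left]
      refine and_congr_right fun _ => ⟨fun hl => ?_, ?_⟩
      · by_cases hl' : m.perm l < m.perm i
        · exact Or.inl hl'
        · exact Or.inr ⟨not_lt.1 hl', hl⟩
      · rintro (hl | hl)
        exacts [hl.trans h.2, hl.2]
    · rw [Finset.disjoint_filter]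
      exact fun l _ hl hl' => absurd hl (not_lt.2 hl'.1)
  have h2 : m.rankU i = m.rankU j + #{l ∈ m.marked | j ≤ l ∧ l < i} := by
    rw [rankU, rankU, ← Finset.card_union_of_disjoint]
    · congr 1
      ext l
      simp only [mem_filter, mem_union, ← and_or_left]
      refine and_congr_right fun _ => ⟨fun hl => ?_, ?_⟩
      · by_cases hl' : l < j
        · exact Or.inl hl'
        · exact Or.inr ⟨not_lt.1 hl', hl⟩
      · rintro (hl | hl)
        exacts [hl.trans h.1, hl.2]
    · rw [Finset.disjoint_filter]
      exact fun l _ hl hl' => absurd hl (not_lt.2 hl'.1)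
  rw [bdiff_eq, bdiff_eq, h1, h2]
  push_cast
  ring

lemma ind_le_card {m : MarkedPM n} {i : Fin (∑ s, n s)} {p : Fin (∑ s, n s) → Prop}
    [DecidablePred p] (h : p i) : m.ind i ≤ #{l ∈ m.marked | p l} := by
  unfold ind
  split_ifs with hi
  · exact_mod_cast Finset.card_pos.2 ⟨i, mem_filter.2 ⟨hi, h⟩⟩
  · positivity

lemma ind_add_ind_le_card {m : MarkedPM n} {i j : Fin (∑ s, n s)} {p : Fin (∑ s, n s) → Prop}
    [DecidablePred p] (hij : i ≠ j) (hi : p i) (hj : p j) :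
    m.ind i + m.ind j ≤ #{l ∈ m.marked | p l} := by
  by_cases h : i ∈ m.marked
  · by_cases h' : j ∈ m.marked
    · rw [ind_of_mem h, ind_of_mem h']
      have : ({i, j} : Finset (Fin (∑ s, n s))) ⊆ ({l ∈ m.marked | p l} : Finset _) := by
        intro x hx
        rw [mem_insert, mem_singleton] at hx
        rcases hx with rfl | rfl <;> simp [*]
      have := Finset.card_le_card this
      rw [Finset.card_pair hij] at this
      exact_mod_cast this
    · rw [ind_of_notMem h', add_zero]; exact ind_le_card hi
  · rw [ind_of_notMem h, zero_add]; exact ind_le_card hj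

/-- If `e_j` crosses `e_i` from the left, its block difference is at least that of `e_i`, and the
two edges themselves contribute to the gap if they are marked. The following two lemmas add the
contribution of a third edge whose lower, respectively upper, endpoint lies in between. -/
lemma add_ind_le_bdiff {m : MarkedPM n} {i j : Fin (∑ s, n s)} (h : m.CrossesLeft j i) :
    m.bdiff i + m.ind i + m.ind j ≤ m.bdiff j := by
  have h1 : m.ind i ≤ _ := ind_le_card (m := m)
    (p := fun l => m.perm i ≤ m.perm l ∧ m.perm l < m.perm j) ⟨le_rfl, h.2⟩
  have h2 : m.ind j ≤ _ := ind_le_card (m := m) (p := fun l => j ≤ l ∧ l < i) ⟨le_rfl, h.1⟩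
  rw [bdiff_of_crossesLeft h]
  linarith

lemma add_ind_le_bdiff_of_lower {m : MarkedPM n} {i j l : Fin (∑ s, n s)} (h : m.CrossesLeft j i)
    (h1 : m.perm i < m.perm l) (h2 : m.perm l < m.perm j) :
    m.bdiff i + m.ind i + m.ind l + m.ind j ≤ m.bdiff j := by
  have h1 : m.ind i + m.ind l ≤ _ := ind_add_ind_le_card (m := m)
    (p := fun l => m.perm i ≤ m.perm l ∧ m.perm l < m.perm j) (fun e => by simp [e] at h1)
    ⟨le_rfl, h.2⟩ ⟨h1.le, h2⟩
  have h2 : m.ind j ≤ _ := ind_le_card (m := m) (p := fun l => j ≤ l ∧ l < i) ⟨le_rfl, h.1⟩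
  rw [bdiff_of_crossesLeft h]
  linarith

lemma add_ind_le_bdiff_of_upper {m : MarkedPM n} {i j l : Fin (∑ s, n s)} (h : m.CrossesLeft j i)
    (h1 : j < l) (h2 : l < i) :
    m.bdiff i + m.ind i + m.ind j + m.ind l ≤ m.bdiff j := by
  have h3 : m.ind i ≤ _ := ind_le_card (m := m)
    (p := fun l => m.perm i ≤ m.perm l ∧ m.perm l < m.perm j) ⟨le_rfl, h.2⟩
  have h4 : m.ind j + m.ind l ≤ _ := ind_add_ind_le_card (m := m) (p := fun l => j ≤ l ∧ l < i)
    h1.ne ⟨le_rfl, h.1⟩ ⟨h1.le, h2⟩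
  rw [bdiff_of_crossesLeft h]
  linarith

lemma mem_marked_of_not_hom {m : MarkedPM n} {i : Fin (∑ s, n s)} (h : ¬ m.Hom i) :
    i ∈ m.marked := m.2 i h

/-- Up to the end of each interval, there are as many upper as lower endpoints of marked edges,
because unmarked edges are homogeneous. -/
lemma card_marked_blk_le (m : MarkedPM n) (r : Fin k) :
    #{j ∈ m.marked | blk n (m.perm j) ≤ r} = #{j ∈ m.marked | blk n j ≤ r} := by
  have h1 : #{j : Fin (∑ s, n s) | blk n (m.perm j) ≤ r} = #{j | blk n j ≤ r} := by
    refine Finset.card_bij (fun j _ => m.perm j) (by simp) (fun a _ b _ h => m.perm.injective h) ?_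
    intro b hb
    exact ⟨m.perm.symm b, by simpa using hb, by simp⟩
  have h2 : #{j ∈ m.markedᶜ | blk n (m.perm j) ≤ r} = #{j ∈ m.markedᶜ | blk n j ≤ r} := by
    congr 1
    refine Finset.filter_congr fun j hj => ?_
    have : m.Hom j := by
      by_contra hn
      exact (mem_compl.1 hj) (mem_marked_of_not_hom hn)
    rw [hom_iff.1 this]
  have split : ∀ p : Fin (∑ s, n s) → Prop, ∀ [DecidablePred p],
      #{j | p j} = #{j ∈ m.marked | p j} + #{j ∈ m.markedᶜ | p j} := by
    intro p _
    rw [← Finset.card_union_of_disjoint]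
    · rw [← Finset.filter_union, Finset.union_compl]
    · exact Finset.disjoint_filter_filter disjoint_compl_right
  rw [split, split, h2] at h1
  omega

/-- An inhomogeneous edge going up to a later interval has positive block difference. -/
lemma bdiff_pos_of_blk_lt {m : MarkedPM n} {j : Fin (∑ s, n s)}
    (h : blk n j < blk n (m.perm j)) : 0 < m.bdiff j := by
  have hj : j ∈ m.marked := mem_marked_of_not_hom fun hh => h.ne (hom_iff.1 hh)
  have h1 : m.rankU j < #{l ∈ m.marked | blk n l ≤ blk n j} := by
    refine Finset.card_lt_card ⟨fun x hx => ?_, fun hs => ?_⟩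
    · simp only [mem_filter] at *
      exact ⟨hx.1, blk_mono hx.2.le⟩
    · have := hs (mem_filter.2 ⟨hj, le_rfl⟩)
      simp at this
  have h2 : #{l ∈ m.marked | blk n (m.perm l) ≤ blk n j} ≤ m.rankL j := by
    refine Finset.card_le_card fun x hx => ?_
    simp only [mem_filter] at *
    refine ⟨hx.1, ?_⟩
    by_contra hn
    exact absurd (blk_mono (n := n) (not_lt.1 hn)) (not_le.2 (hx.2.trans_lt h))
  rw [card_marked_blk_le] at h2
  rw [bdiff_eq]
  omega

/-- An inhomogeneous edge crossing a homogeneous edge from the right, and going to an earlier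
interval, has negative block difference, and less than `-1` if the homogeneous edge is marked. -/
lemma bdiff_le_of_blk_lt {m : MarkedPM n} {i j : Fin (∑ s, n s)} (hi : m.Hom i)
    (hc : m.CrossesRight j i) (h : blk n (m.perm j) < blk n j) :
    m.bdiff j ≤ -1 - m.ind i := by
  have hj : j ∈ m.marked := mem_marked_of_not_hom fun hh => h.ne (hom_iff.1 hh).symm
  have hb := hom_iff.1 hi
  have hb1 : blk n i ≤ blk n j := blk_mono hc.1.le
  have hb2 : blk n (m.perm j) ≤ blk n (m.perm i) := blk_mono hc.2.le
  rcases hb2.lt_or_eq with hlt | heq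
  · -- `e_j` ends before the interval of `e_i`: all upper endpoints up to the end of the interval of
    -- `π(j)` precede `j`, and so does `i`, while the lower endpoint of `e_j` itself is not counted
    have h1 : (m.rankL j : ℤ) < #{l ∈ m.marked | blk n (m.perm l) ≤ blk n (m.perm j)} := by
      norm_cast
      refine Finset.card_lt_card ⟨fun x hx => ?_, fun hs => ?_⟩
      · simp only [mem_filter] at *
        exact ⟨hx.1, blk_mono hx.2.le⟩
      · have := hs (mem_filter.2 ⟨hj, le_rfl⟩)
        simp at this
    have h2 : #{l ∈ m.marked | blk n l ≤ blk n (m.perm j)} + m.ind i ≤ m.rankU j := by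
      have h3 : m.ind i ≤ #{l ∈ m.marked | l = i} := ind_le_card rfl
      have h4 : #{l ∈ m.marked | blk n l ≤ blk n (m.perm j)} + #{l ∈ m.marked | l = i}
          ≤ m.rankU j := by
        rw [← Finset.card_union_of_disjoint]
        · refine Finset.card_le_card fun x hx => ?_
          simp only [mem_union, mem_filter] at *
          rcases hx with hx | hx
          · refine ⟨hx.1, ?_⟩
            by_contra hn
            exact absurd (blk_mono (n := n) (not_lt.1 hn)) (not_le.2 (hx.2.trans_lt h))
          · rw [hx.2]; exact ⟨hx.2 ▸ hx.1, hc.1⟩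
        · rw [Finset.disjoint_filter]
          rintro x _ hx rfl
          exact absurd (hb ▸ hx) (not_le.2 hlt)
      have h5 : ((#{l ∈ m.marked | blk n l ≤ blk n (m.perm j)} : ℕ) : ℤ) +
        (#{l ∈ m.marked | l = i} : ℕ) ≤ m.rankU j := by exact_mod_cast h4
      linarith
    rw [card_marked_blk_le] at h1
    rw [bdiff_eq]
    linarith
  · -- `e_j` ends in the interval of `e_i`: the lower endpoints of both `e_i` and `e_j` are missing
    have h1 : (m.rankL j : ℤ) + (m.ind i + m.ind j) ≤
        #{l ∈ m.marked | blk n (m.perm l) ≤ blk n (m.perm j)} := by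
      have h3 : m.ind i + m.ind j ≤ #{l ∈ m.marked | l = i ∨ l = j} :=
        ind_add_ind_le_card hc.1.ne (Or.inl rfl) (Or.inr rfl)
      have h4 : m.rankL j + #{l ∈ m.marked | l = i ∨ l = j} ≤
          #{l ∈ m.marked | blk n (m.perm l) ≤ blk n (m.perm j)} := by
        rw [rankL, ← Finset.card_union_of_disjoint]
        · refine Finset.card_le_card fun x hx => ?_
          simp only [mem_union, mem_filter] at *
          rcases hx with hx | ⟨hx, rfl | rfl⟩
          exacts [⟨hx.1, blk_mono hx.2.le⟩, ⟨hx, heq.ge⟩, ⟨hx, le_rfl⟩]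
        · rw [Finset.disjoint_filter]
          rintro x _ hx (rfl | rfl)
          exacts [absurd hx (not_lt.2 hc.2.le), lt_irrefl _ hx]
      have h5 : (m.rankL j : ℤ) + (#{l ∈ m.marked | l = i ∨ l = j} : ℕ) ≤
        #{l ∈ m.marked | blk n (m.perm l) ≤ blk n (m.perm j)} := by exact_mod_cast h4
      linarith
    have h2 : (#{l ∈ m.marked | blk n l ≤ blk n (m.perm j)} : ℤ) ≤ m.rankU j := by
      norm_cast
      refine Finset.card_le_card fun x hx => ?_
      simp only [mem_filter] at *
      refine ⟨hx.1, ?_⟩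
      by_contra hn
      exact absurd (blk_mono (n := n) (not_lt.1 hn)) (not_le.2 (hx.2.trans_lt h))
    rw [card_marked_blk_le, ind_of_mem hj] at h1
    rw [bdiff_eq]
    linarith

/-! ### Convertible edges -/

lemma convertible_iff {m : MarkedPM n} {i : Fin (∑ s, n s)} :
    m.Convertible i ↔ m.Hom i ∧ (∀ j, m.CrossesLeft j i → m.ind i ≤ m.bdiff j) ∧
      ∀ j, m.CrossesRight j i → m.bdiff j ≤ -1 - m.ind i := by
  have hex : ∀ j, m.CrossesLeft j i → ¬ m.CrossesRight j i := fun j h h' => lt_asymm h.1 h'.1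
  unfold Convertible
  refine and_congr_right fun _ => ?_
  by_cases hi : i ∈ m.marked
  · simp only [hi, not_true_eq_false, false_imp_iff, true_imp_iff, true_and, ind_of_mem hi]
    refine ⟨fun h => ⟨fun j hj => ?_, fun j hj => ?_⟩, fun h j hj => ?_⟩
    · rcases h j (Or.inl hj) with h | h
      exacts [h.2, absurd h.1 (hex j hj)]
    · rcases h j (Or.inr hj) with h | h
      exacts [absurd hj (hex j h.1), by have := h.2; omega]
    · rcases hj with hj | hj
      exacts [Or.inl ⟨hj, h.1 j hj⟩, Or.inr ⟨hj, by have := h.2 j hj; omega⟩]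
  · simp only [hi, not_false_eq_true, false_imp_iff, true_imp_iff, and_true, ind_of_notMem hi]
    refine ⟨fun h => ⟨fun j hj => ?_, fun j hj => ?_⟩, fun h j hj => ?_⟩
    · rcases h j (Or.inl hj) with h | h
      exacts [h.2, absurd h.1 (hex j hj)]
    · rcases h j (Or.inr hj) with h | h
      exacts [absurd hj (hex j h.1), by have := h.2; omega]
    · rcases hj with hj | hj
      exacts [Or.inl ⟨hj, h.1 j hj⟩, Or.inr ⟨hj, by have := h.2 j hj; omega⟩]

/-- Only homogeneous edges can obstruct the convertibility of a homogeneous edge. -/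
lemma convertible_of_hom {m : MarkedPM n} {i : Fin (∑ s, n s)} (hi : m.Hom i)
    (hL : ∀ j, m.Hom j → m.CrossesLeft j i → m.ind i ≤ m.bdiff j)
    (hR : ∀ j, m.Hom j → m.CrossesRight j i → m.bdiff j ≤ -1 - m.ind i) : m.Convertible i := by
  refine convertible_iff.2 ⟨hi, fun j hj => ?_, fun j hj => ?_⟩
  · by_cases h : m.Hom j
    · exact hL j h hj
    · have h1 : blk n j ≤ blk n (m.perm j) :=
        ((blk_mono hj.1.le).trans (hom_iff.1 hi).le).trans (blk_mono hj.2.le)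
      have h2 := bdiff_pos_of_blk_lt (h1.lt_of_ne fun e => h (hom_iff.2 e))
      unfold ind
      split_ifs <;> omega
  · by_cases h : m.Hom j
    · exact hR j h hj
    · have h1 : blk n (m.perm j) ≤ blk n j :=
        ((blk_mono hj.2.le).trans (hom_iff.1 hi).ge).trans (blk_mono hj.1.le)
      exact bdiff_le_of_blk_lt hi hj (h1.lt_of_ne fun e => h (hom_iff.2 e.symm))

/-! ### Toggling a mark -/

lemma toggle_toggle (m : MarkedPM n) (i : Fin (∑ s, n s)) (hi : m.Hom i) :
    (m.toggle i hi).toggle i hi = m := by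
  apply Subtype.ext
  refine Prod.ext rfl ?_
  exact symmDiff_symmDiff_cancel_right _ _

lemma perm_toggle (m : MarkedPM n) (i : Fin (∑ s, n s)) (hi : m.Hom i) :
    (m.toggle i hi).perm = m.perm := rfl

lemma marked_toggle (m : MarkedPM n) (i : Fin (∑ s, n s)) (hi : m.Hom i) :
    (m.toggle i hi).marked = symmDiff m.marked {i} := rfl

lemma mem_marked_toggle {m : MarkedPM n} {i j : Fin (∑ s, n s)} {hi : m.Hom i} :
    j ∈ (m.toggle i hi).marked ↔ ((j ∈ m.marked ∧ j ≠ i) ∨ (j ∉ m.marked ∧ j = i)) := by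
  rw [marked_toggle, mem_symmDiff, mem_singleton]
  tauto

lemma marked_toggle_of_notMem {m : MarkedPM n} {i : Fin (∑ s, n s)} (hi : m.Hom i)
    (h : i ∉ m.marked) : (m.toggle i hi).marked = insert i m.marked := by
  ext j
  rw [mem_marked_toggle, mem_insert]
  by_cases hj : j = i
  · subst hj; simp [h]
  · simp [hj]

lemma bdiff_toggle_of_notMem {m : MarkedPM n} {i : Fin (∑ s, n s)} (hi : m.Hom i)
    (h : i ∉ m.marked) (j : Fin (∑ s, n s)) :
    (m.toggle i hi).bdiff j = m.bdiff j + (if m.perm i < m.perm j then 1 else 0) -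
      (if i < j then 1 else 0) := by
  rw [bdiff_eq, bdiff_eq, rankL, rankU, marked_toggle_of_notMem hi h, perm_toggle,
    Finset.filter_insert, Finset.filter_insert]
  split_ifs <;> simp [rankL, rankU, h] <;> ring

lemma bdiff_toggle_of_mem {m : MarkedPM n} {i : Fin (∑ s, n s)} (hi : m.Hom i)
    (h : i ∈ m.marked) (j : Fin (∑ s, n s)) :
    (m.toggle i hi).bdiff j = m.bdiff j - (if m.perm i < m.perm j then 1 else 0) +
      (if i < j then 1 else 0) := by
  have h' : i ∉ (m.toggle i hi).marked := by simp [mem_marked_toggle, h]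
  have := bdiff_toggle_of_notMem (m := m.toggle i hi) (i := i) hi h' j
  rw [toggle_toggle, perm_toggle] at this
  linarith

lemma ind_toggle_self {m : MarkedPM n} {i : Fin (∑ s, n s)} (hi : m.Hom i) :
    (m.toggle i hi).ind i = 1 - m.ind i := by
  by_cases h : i ∈ m.marked <;> simp [ind, mem_marked_toggle, h]

lemma bdiff_toggle_of_crossesLeft {m : MarkedPM n} {i j : Fin (∑ s, n s)} (hi : m.Hom i)
    (h : m.CrossesLeft j i) : (m.toggle i hi).bdiff j = m.bdiff j + 1 - 2 * m.ind i := by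
  by_cases h' : i ∈ m.marked
  · rw [bdiff_toggle_of_mem hi h', if_pos h.2, if_neg (not_lt.2 h.1.le), ind_of_mem h']; ring
  · rw [bdiff_toggle_of_notMem hi h', if_pos h.2, if_neg (not_lt.2 h.1.le), ind_of_notMem h']; ring

lemma bdiff_toggle_of_crossesRight {m : MarkedPM n} {i j : Fin (∑ s, n s)} (hi : m.Hom i)
    (h : m.CrossesRight j i) : (m.toggle i hi).bdiff j = m.bdiff j - 1 + 2 * m.ind i := by
  by_cases h' : i ∈ m.marked
  · rw [bdiff_toggle_of_mem hi h', if_pos h.1, if_neg (not_lt.2 h.2.le), ind_of_mem h']; ring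
  · rw [bdiff_toggle_of_notMem hi h', if_pos h.1, if_neg (not_lt.2 h.2.le), ind_of_notMem h']; ring

lemma bdiff_toggle_of_not_crosses {m : MarkedPM n} {i j : Fin (∑ s, n s)} (hi : m.Hom i)
    (h1 : ¬ m.CrossesLeft j i) (h2 : ¬ m.CrossesRight j i) :
    (m.toggle i hi).bdiff j = m.bdiff j := by
  have key : m.perm i < m.perm j ↔ i < j := by
    rcases lt_trichotomy j i with h | rfl | h
    · have h3 : ¬ m.perm i < m.perm j := fun hh => h1 ⟨h, hh⟩
      simp [h3, h.le]
    · simp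
    · have h3 : ¬ m.perm j < m.perm i := fun hh => h2 ⟨h, hh⟩
      have h4 : m.perm i ≠ m.perm j := fun hh => h.ne (m.perm.injective hh)
      simp [(not_lt.1 h3).lt_of_ne h4, h]
  by_cases h' : i ∈ m.marked
  · rw [bdiff_toggle_of_mem hi h']; simp [key]
  · rw [bdiff_toggle_of_notMem hi h']; simp [key]

lemma bdiff_toggle_self {m : MarkedPM n} {i : Fin (∑ s, n s)} (hi : m.Hom i) :
    (m.toggle i hi).bdiff i = m.bdiff i :=
  bdiff_toggle_of_not_crosses hi (fun h => lt_irrefl _ h.1) (fun h => lt_irrefl _ h.1)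

lemma ind_le_one (m : MarkedPM n) (i : Fin (∑ s, n s)) : m.ind i ≤ 1 := by
  unfold ind; split_ifs <;> simp

/-- Toggling a convertible edge preserves the signs of all block differences. -/
lemma Convertible.bdiff_toggle_nonneg_iff {m : MarkedPM n} {i : Fin (∑ s, n s)}
    (h : m.Convertible i) (j : Fin (∑ s, n s)) :
    0 ≤ (m.toggle i h.1).bdiff j ↔ 0 ≤ m.bdiff j := by
  obtain ⟨hi, hL, hR⟩ := convertible_iff.1 h
  have h0 := m.ind_nonneg i
  have h1 := m.ind_le_one i
  by_cases hl : m.CrossesLeft j i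
  · rw [bdiff_toggle_of_crossesLeft hi hl]
    have := hL j hl
    omega
  · by_cases hr : m.CrossesRight j i
    · rw [bdiff_toggle_of_crossesRight hi hr]
      have := hR j hr
      omega
    · rw [bdiff_toggle_of_not_crosses hi hl hr]

lemma Convertible.toggle {m : MarkedPM n} {i : Fin (∑ s, n s)} (h : m.Convertible i) :
    (m.toggle i h.1).Convertible i := by
  obtain ⟨hi, hL, hR⟩ := convertible_iff.1 h
  have h0 := m.ind_nonneg i
  have h1 := m.ind_le_one i
  refine convertible_iff.2 ⟨hi, fun j hj => ?_, fun j hj => ?_⟩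
  · rw [ind_toggle_self, bdiff_toggle_of_crossesLeft hi hj]
    have := hL j hj
    omega
  · rw [ind_toggle_self, bdiff_toggle_of_crossesRight hi hj]
    have := hR j hj
    omega

lemma Convertible.bwex_toggle {m : MarkedPM n} {i : Fin (∑ s, n s)} (h : m.Convertible i) :
    (m.toggle i h.1).bwex = m.bwex := by
  rw [bwex_eq, bwex_eq]
  simp only [h.bdiff_toggle_nonneg_iff]

lemma Convertible.wt_add_cross_toggle_of_notMem {m : MarkedPM n} {i : Fin (∑ s, n s)}
    (h : m.Convertible i) (hm : i ∉ m.marked) :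
    (m.toggle i h.1).wt + (m.toggle i h.1).cross = m.wt + m.cross := by
  obtain ⟨hi, hL, hR⟩ := convertible_iff.1 h
  have hwt : (m.toggle i h.1).wt = m.wt + #{j | m.CrossesLeft j i ∨ m.CrossesRight j i} := by
    rw [wt_eq, wt_eq, Finset.natCast_card_filter, ← Finset.sum_add_distrib]
    refine Finset.sum_congr rfl fun j _ => ?_
    by_cases hl : m.CrossesLeft j i
    · rw [bdiff_toggle_of_crossesLeft hi hl, ind_of_notMem hm, if_pos (Or.inl hl)]
      have := hL j hl
      rw [ind_of_notMem hm] at this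
      rw [diffWeight, if_pos (by omega), diffWeight, if_pos this]
      ring
    · by_cases hr : m.CrossesRight j i
      · rw [bdiff_toggle_of_crossesRight hi hr, ind_of_notMem hm, if_pos (Or.inr hr)]
        have := hR j hr
        rw [ind_of_notMem hm] at this
        rw [diffWeight, if_neg (by omega), diffWeight, if_neg (by omega)]
        ring
      · rw [bdiff_toggle_of_not_crosses hi hl hr,
          if_neg (not_or.2 ⟨hl, hr⟩), add_zero]
  have hc : m.markedᶜ = insert i (m.toggle i h.1).markedᶜ := by
    rw [marked_toggle_of_notMem h.1 hm]
    ext j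
    by_cases hj : j = i
    · subst hj; simp [hm]
    · simp [hj]
  have hi' : i ∉ (m.toggle i h.1).markedᶜ := by simp [mem_marked_toggle, hm]
  have hcross : m.cross = (m.toggle i h.1).cross +
      #{j | m.CrossesLeft j i ∨ m.CrossesRight j i} := by
    have hsplit : ({j | m.CrossesLeft j i ∨ m.CrossesRight j i} : Finset (Fin (∑ s, n s))) =
        {j ∈ (m.toggle i h.1).markedᶜ | (j < i ∧ m.perm i < m.perm j) ∨
          (i < j ∧ m.perm j < m.perm i)} ∪
        {j ∈ m.marked | (j < i ∧ m.perm i < m.perm j) ∨ (i < j ∧ m.perm j < m.perm i)} := by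
      rw [← Finset.filter_union]
      ext j
      simp only [mem_filter, mem_univ, true_and, mem_union]
      refine ⟨fun hj => ⟨?_, hj⟩, fun hj => hj.2⟩
      have hji : j ≠ i := by
        rintro rfl
        rcases hj with hj | hj <;> exact lt_irrefl _ hj.1
      by_cases hjm : j ∈ m.marked
      · exact Or.inr hjm
      · exact Or.inl (by simp [mem_marked_toggle, hjm, hji])
    rw [hsplit, Finset.card_union_of_disjoint]
    · rw [cross_eq, cross_eq, hc, invOn_insert _ hi', perm_toggle,
        marked_toggle_of_notMem h.1 hm, invOn_insert _ hm]
      push_cast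
      ring
    · refine Finset.disjoint_filter_filter (Finset.disjoint_left.2 fun j h1 h2 => ?_)
      rw [marked_toggle_of_notMem h.1 hm] at h1
      simp [h2] at h1
  rw [hwt, hcross]
  ring

/-- Toggling a convertible edge shifts the weight of every edge crossing it by one, which the
change of the crossing number compensates. -/
lemma Convertible.wt_add_cross_toggle {m : MarkedPM n} {i : Fin (∑ s, n s)}
    (h : m.Convertible i) : (m.toggle i h.1).wt + (m.toggle i h.1).cross = m.wt + m.cross := by
  by_cases hm : i ∈ m.marked
  · have := h.toggle.wt_add_cross_toggle_of_notMem (by simp [mem_marked_toggle, hm])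
    rw [toggle_toggle] at this
    exact this.symm
  · exact h.wt_add_cross_toggle_of_notMem hm

lemma neg_one_pow_numEdges_toggle (m : MarkedPM n) {i : Fin (∑ s, n s)} (hi : m.Hom i) :
    (-1 : ℤ) ^ (m.toggle i hi).numEdges = -(-1) ^ m.numEdges := by
  have key : ∀ (m : MarkedPM n) (hi : m.Hom i), i ∉ m.marked →
      m.numEdges = (m.toggle i hi).numEdges + 1 := by
    intro m hi hm
    rw [numEdges_eq, numEdges_eq, marked_toggle_of_notMem hi hm, card_compl, card_compl,
      card_insert_of_notMem hm]
    have : #(insert i m.marked) ≤ _ := Finset.card_le_univ _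
    rw [card_insert_of_notMem hm] at this
    omega
  by_cases hm : i ∈ m.marked
  · have := key (m.toggle i hi) hi (by simp [mem_marked_toggle, hm])
    rw [toggle_toggle] at this
    rw [this, pow_succ]
    ring
  · rw [key m hi hm, pow_succ]
    ring

/-! ### The sign-reversing involution -/

/-- `e_i` is the edge whose mark the involution toggles. -/
def IsToggled (m : MarkedPM n) (i : Fin (∑ s, n s)) : Prop :=
  ((∀ j, m.Hom j → 0 ≤ m.bdiff j) ∧ m.Hom i ∧ ∀ j, m.Hom j → m.perm i ≤ m.perm j) ∨
  ∃ a, m.Hom a ∧ m.bdiff a < 0 ∧ (∀ b, m.Hom b → m.bdiff b < 0 → a ≤ b) ∧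
    ((m.Convertible a ∧ i = a) ∨
      (¬ m.Convertible a ∧ i ∈ m.homZero a ∧ ∀ b ∈ m.homZero a, b ≤ i))

lemma mem_homZero {m : MarkedPM n} {i j : Fin (∑ s, n s)} :
    j ∈ m.homZero i ↔ m.Hom j ∧ m.bdiff j = 0 ∧ m.CrossesLeft j i := by
  simp only [homZero, mem_filter, mem_univ, true_and]
  constructor
  · rintro ⟨h1, h2, h3, h4 | h4⟩
    exacts [⟨h2, h3, h4⟩, absurd h1 (not_lt.2 h4.1.le)]
  · rintro ⟨h1, h2, h3⟩
    exact ⟨h3.1, h1, h2, Or.inl h3⟩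

lemma mem_homNeg {m : MarkedPM n} {i : Fin (∑ s, n s)} :
    i ∈ m.homNeg ↔ m.Hom i ∧ m.bdiff i < 0 := by simp [homNeg]

lemma IsToggled.hom {m : MarkedPM n} {i : Fin (∑ s, n s)} (h : m.IsToggled i) : m.Hom i := by
  rcases h with h | ⟨a, ha, _, _, h | h⟩
  exacts [h.2.1, h.2 ▸ ha, (mem_homZero.1 h.2.1).1]

lemma IsToggled.toggled_eq {m : MarkedPM n} {i : Fin (∑ s, n s)} (h : m.IsToggled i) :
    m.toggled = some ⟨i, h.hom⟩ := by
  unfold toggled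
  rcases id h with h | ⟨a, ha, ha0, hmin, h⟩
  · have h1 : ¬ m.homNeg.Nonempty := by
      rintro ⟨j, hj⟩
      exact absurd (h.1 j (mem_homNeg.1 hj).1) (not_le.2 (mem_homNeg.1 hj).2)
    have h2 : m.perm i ∈ m.homLower := by simpa [homLower] using h.2.1
    have h3 : m.homLower.Nonempty := ⟨_, h2⟩
    rw [dif_neg h1, dif_pos h3]
    congr 2
    rw [Equiv.symm_apply_eq]
    refine le_antisymm (Finset.min'_le _ _ h2) (Finset.le_min' _ _ _ fun l hl => ?_)
    have := h.2.2 (m.perm.symm l) (by simpa [homLower] using hl)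
    simpa using this
  · have h2 : a ∈ m.homNeg := mem_homNeg.2 ⟨ha, ha0⟩
    have h3 : m.homNeg.Nonempty := ⟨_, h2⟩
    have h4 : m.homNeg.min' h3 = a :=
      le_antisymm (Finset.min'_le _ _ h2) (Finset.le_min' _ _ _ fun b hb =>
        hmin b (mem_homNeg.1 hb).1 (mem_homNeg.1 hb).2)
    rw [dif_pos h3]
    rcases h with ⟨hc, rfl⟩ | ⟨hc, hi, hmax⟩
    · rw [if_pos (by rw [h4]; exact hc)]
      congr 2
    · rw [if_neg (by rw [h4]; exact hc)]
      have h5 : (m.homZero (m.homNeg.min' h3)).Nonempty := by rw [h4]; exact ⟨i, hi⟩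
      rw [dif_pos h5]
      congr 2
      refine le_antisymm (Finset.max'_le _ _ _ fun b hb => hmax b (h4 ▸ hb))
        (Finset.le_max' _ _ (by rw [h4]; exact hi))

lemma IsToggled.phi_eq {m : MarkedPM n} {i : Fin (∑ s, n s)} (h : m.IsToggled i) :
    m.Phi = m.toggle i h.hom := by
  rw [Phi, h.toggled_eq]

lemma IsDerangement.phi_eq {m : MarkedPM n} (h : m.IsDerangement) : m.Phi = m := by
  have h1 : ¬ m.homNeg.Nonempty := by
    rintro ⟨j, hj⟩
    exact h j (mem_homNeg.1 hj).1
  have h2 : ¬ m.homLower.Nonempty := by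
    rintro ⟨j, hj⟩
    exact h _ (mem_filter.1 hj).2
  rw [Phi, toggled, dif_neg h1, dif_neg h2]

/-- If the first homogeneous edge `e_a` of negative block difference is not convertible, then it is
marked and an edge of `homZero a` obstructs it. -/
lemma mem_marked_and_nonempty_homZero {m : MarkedPM n} {a : Fin (∑ s, n s)} (ha : m.Hom a)
    (ha0 : m.bdiff a < 0) (hmin : ∀ b, m.Hom b → m.bdiff b < 0 → a ≤ b)
    (hc : ¬ m.Convertible a) : a ∈ m.marked ∧ (m.homZero a).Nonempty := by
  by_contra hcon
  refine hc (convertible_of_hom ha (fun j hj hl => ?_) (fun j hj hr => ?_))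
  · have h1 : 0 ≤ m.bdiff j := by
      by_contra hn
      exact absurd (hmin j hj (not_le.1 hn)) (not_le.2 hl.1)
    by_cases hm : a ∈ m.marked
    · rw [ind_of_mem hm]
      by_contra hn
      exact hcon ⟨hm, j, mem_homZero.2 ⟨hj, by omega, hl⟩⟩
    · rw [ind_of_notMem hm]; exact h1
  · have h1 := add_ind_le_bdiff (m := m) (i := j) (j := a) hr
    have := m.ind_nonneg j
    linarith

lemma exists_isToggled {m : MarkedPM n} (h : ¬ m.IsDerangement) : ∃ i, m.IsToggled i := by
  by_cases hneg : m.homNeg.Nonempty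
  · obtain ⟨h1, h2⟩ := mem_homNeg.1 (m.homNeg.min'_mem hneg)
    have h3 : ∀ b, m.Hom b → m.bdiff b < 0 → m.homNeg.min' hneg ≤ b := fun b hb hb0 =>
      Finset.min'_le _ _ (mem_homNeg.2 ⟨hb, hb0⟩)
    by_cases hc : m.Convertible (m.homNeg.min' hneg)
    · exact ⟨_, Or.inr ⟨_, h1, h2, h3, Or.inl ⟨hc, rfl⟩⟩⟩
    · have hz := (mem_marked_and_nonempty_homZero h1 h2 h3 hc).2
      exact ⟨_, Or.inr ⟨_, h1, h2, h3, Or.inr ⟨hc, Finset.max'_mem _ hz,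
        fun b hb => Finset.le_max' _ _ hb⟩⟩⟩
  · have h1 : ∃ j, m.Hom j := by
      unfold IsDerangement at h
      push Not at h
      exact h
    obtain ⟨j, hj⟩ := h1
    have h2 : m.homLower.Nonempty := ⟨m.perm j, by simpa [homLower] using hj⟩
    refine ⟨m.perm.symm (m.homLower.min' h2), Or.inl ⟨fun j hj => ?_, ?_, fun j hj => ?_⟩⟩
    · by_contra hn
      exact hneg ⟨j, mem_homNeg.2 ⟨hj, not_le.1 hn⟩⟩
    · exact (mem_filter.1 (m.homLower.min'_mem h2)).2
    · rw [Equiv.apply_symm_apply]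
      exact Finset.min'_le _ _ (by simpa [homLower] using hj)

/-- The toggled edge is convertible. In the last case, an edge `e_j` obstructing the last element
`e_i` of `homZero a` would have to cross it from the right; it either belongs to `homZero a`, or
the monotonicity of block differences along crossings, applied with the marked edge `e_a`,
contradicts `e_i` having block difference `0`. -/
lemma IsToggled.convertible {m : MarkedPM n} {i : Fin (∑ s, n s)} (h : m.IsToggled i) :
    m.Convertible i := by
  rcases h with ⟨hnn, hi, hmin⟩ | ⟨a, ha, ha0, hmin, ⟨hc, rfl⟩ | ⟨hc, hz, hmax⟩⟩
  · refine convertible_of_hom hi (fun j hj hl => ?_) (fun j hj hr => ?_)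
    · have h1 := add_ind_le_bdiff hl
      have h2 := m.ind_nonneg j
      have h3 := hnn i hi
      linarith
    · exact absurd (hmin j hj) (not_le.2 hr.2)
  · exact hc
  · obtain ⟨hi, hi0, hia⟩ := mem_homZero.1 hz
    have ham := (mem_marked_and_nonempty_homZero ha ha0 hmin hc).1
    have hia' := add_ind_le_bdiff hia
    rw [ind_of_mem ham, hi0] at hia'
    have hi2 := m.ind_nonneg i
    refine convertible_of_hom hi (fun j hj hl => ?_) (fun j hj hr => ?_)
    · have h1 := add_ind_le_bdiff hl
      have h2 := m.ind_nonneg j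
      linarith
    · have hil : m.CrossesLeft i j := hr
      have h2 := m.ind_nonneg j
      rcases lt_trichotomy j a with hja | rfl | hja
      · -- `e_j` lies before `e_a`, so its block difference is nonnegative
        exfalso
        have hj0 : 0 ≤ m.bdiff j := by
          by_contra hn
          exact absurd (hmin j hj (not_le.1 hn)) (not_le.2 hja)
        rcases lt_trichotomy (m.perm a) (m.perm j) with hp | hp | hp
        · have h3 := add_ind_le_bdiff hil
          exact absurd (hmax j (mem_homZero.2 ⟨hj, by linarith, hja, hp⟩)) (not_le.2 hr.1)
        · exact hja.ne (m.perm.injective hp).symm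
        · have h3 := add_ind_le_bdiff_of_lower hil hp hia.2
          rw [ind_of_mem ham] at h3
          linarith
      · linarith
      · -- `e_j` lies after `e_a`, so the upper endpoint of `e_a` or `e_a` itself forces the gap
        rcases lt_trichotomy (m.perm a) (m.perm j) with hp | hp | hp
        · have h3 := add_ind_le_bdiff_of_upper hil hia.1 hja
          rw [ind_of_mem ham] at h3
          linarith
        · exact absurd (m.perm.injective hp) hja.ne
        · have h3 := add_ind_le_bdiff (m := m) (i := j) (j := a) ⟨hja, hp⟩
          rw [ind_of_mem ham] at h3
          linarith

/-- The edge chosen by the involution is chosen again after toggling it. -/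
lemma IsToggled.toggle {m : MarkedPM n} {i : Fin (∑ s, n s)} (h : m.IsToggled i) :
    (m.toggle i h.hom).IsToggled i := by
  have hconv := h.convertible
  have hsign := hconv.bdiff_toggle_nonneg_iff
  have hsign' : ∀ j, (m.toggle i h.hom).bdiff j < 0 ↔ m.bdiff j < 0 := fun j => by
    rw [← not_le, ← not_le, hsign]
  rcases id h with ⟨hnn, hi, hmin⟩ | ⟨a, ha, ha0, hmin, ⟨hc, rfl⟩ | ⟨hc, hz, hmax⟩⟩
  · exact Or.inl ⟨fun j hj => (hsign j).2 (hnn j hj), hi, hmin⟩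
  · exact Or.inr ⟨i, ha, (hsign' i).2 ha0, fun b hb hb0 => hmin b hb ((hsign' b).1 hb0),
      Or.inl ⟨hconv.toggle, rfl⟩⟩
  · obtain ⟨hi, hi0, hia⟩ := mem_homZero.1 hz
    have ham := (mem_marked_and_nonempty_homZero ha ha0 hmin hc).1
    refine Or.inr ⟨a, ha, (hsign' a).2 ha0, fun b hb hb0 => hmin b hb ((hsign' b).1 hb0),
      Or.inr ⟨fun hc' => ?_, mem_homZero.2 ⟨hi, (bdiff_toggle_self h.hom).trans hi0, hia⟩,
        fun b hb => ?_⟩⟩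
    · have h1 := (convertible_iff.1 hc').2.1 i hia
      rw [bdiff_toggle_self h.hom, hi0, ind_of_mem (mem_marked_toggle.2 (Or.inl ⟨ham, hia.1.ne'⟩))]
        at h1
      omega
    · obtain ⟨hb1, hb2, hb3⟩ := mem_homZero.1 hb
      by_contra hn
      rw [not_le] at hn
      have hl : ¬ m.CrossesLeft b i := fun hh => lt_asymm hh.1 hn
      by_cases hr : m.CrossesRight b i
      · have h1 := (convertible_iff.1 hconv).2.2 b hr
        have h2 := (hsign b).1 hb2.ge
        have := m.ind_nonneg i
        omega
      · rw [bdiff_toggle_of_not_crosses h.hom hl hr] at hb2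
        exact absurd (hmax b (mem_homZero.2 ⟨hb1, hb2, hb3⟩)) (not_le.2 hn)

lemma phi_phi (m : MarkedPM n) : m.Phi.Phi = m := by
  by_cases h : m.IsDerangement
  · rw [h.phi_eq, h.phi_eq]
  · obtain ⟨i, hi⟩ := exists_isToggled h
    rw [hi.phi_eq, hi.toggle.phi_eq, toggle_toggle]

lemma neg_one_pow_numEdges_phi {m : MarkedPM n} (h : ¬ m.IsDerangement) :
    (-1 : ℤ) ^ m.Phi.numEdges = -(-1) ^ m.numEdges := by
  obtain ⟨i, hi⟩ := exists_isToggled h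
  rw [hi.phi_eq, neg_one_pow_numEdges_toggle]

lemma phi_eq_self_iff (m : MarkedPM n) : m.Phi = m ↔ m.IsDerangement := by
  refine ⟨fun h => ?_, IsDerangement.phi_eq⟩
  by_contra hd
  have := neg_one_pow_numEdges_phi hd
  rw [h] at this
  rcases neg_one_pow_eq_or ℤ m.numEdges with h' | h' <;> rw [h'] at this <;> norm_num at this

lemma exists_convertible_phi {m : MarkedPM n} (h : ¬ m.IsDerangement) :
    ∃ i, m.Convertible i ∧ m.Phi.perm = m.perm ∧ m.Phi.marked = symmDiff m.marked {i} := by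
  obtain ⟨i, hi⟩ := exists_isToggled h
  exact ⟨i, hi.convertible, by rw [hi.phi_eq, perm_toggle], by rw [hi.phi_eq, marked_toggle]⟩

lemma bwex_phi (m : MarkedPM n) : m.Phi.bwex = m.bwex := by
  by_cases h : m.IsDerangement
  · rw [h.phi_eq]
  · obtain ⟨i, hi⟩ := exists_isToggled h
    rw [hi.phi_eq, hi.convertible.bwex_toggle]

lemma wt_add_cross_phi (m : MarkedPM n) : m.Phi.wt + m.Phi.cross = m.wt + m.cross := by
  by_cases h : m.IsDerangement
  · rw [h.phi_eq]
  · obtain ⟨i, hi⟩ := exists_isToggled h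
    rw [hi.phi_eq, hi.convertible.wt_add_cross_toggle]

end MarkedPM

/-! ### Crossings, weights and inversions of permutations -/

section Crossings

variable {N : ℕ} (σ : Equiv.Perm (Fin N))

lemma card_filter_prod (p : Fin N → Fin N → Prop) [∀ a b, Decidable (p a b)] :
    #{x : Fin N × Fin N | p x.1 x.2} = ∑ a, #{b | p a b} := by
  simp only [Finset.card_filter, ← Finset.univ_product_univ, Finset.sum_product]

lemma card_filter_prod_right (p : Fin N → Fin N → Prop) [∀ a b, Decidable (p a b)] :
    #{x : Fin N × Fin N | p x.1 x.2} = ∑ b, #{a | p a b} := by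
  simp only [Finset.card_filter, ← Finset.univ_product_univ, Finset.sum_product_right]

/-- `|σ(i) - i|` or `|σ(i) - i| - 1` counts the positions in `(i, σ(i)]` if `i` is a weak excedance,
and the values in `(σ(i), i)` otherwise. -/
lemma diffWeight_sub (i : Fin N) :
    diffWeight (((σ i : ℕ) : ℤ) - ((i : ℕ) : ℤ)) =
      #{j | i < j ∧ j ≤ σ i} + #{j | σ i < σ j ∧ σ j < i} := by
  have h1 : #{j | i < j ∧ j ≤ σ i} = (σ i : ℕ) - i := by
    rw [← Fin.card_Ioc]
    congr 1
    ext j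
    simp
  have h2 : #{j | σ i < σ j ∧ σ j < i} = (i : ℕ) - σ i - 1 := by
    rw [← Fin.card_Ioo]
    refine Finset.card_bij (fun j _ => σ j) (by simp) (fun a _ b _ h => σ.injective h) ?_
    intro b hb
    exact ⟨σ.symm b, by simpa using hb, by simp⟩
  rw [h1, h2, diffWeight]
  split_ifs <;> omega

/-- Each inversion `(i, j)` is counted by the weight of `i` if `j ≤ σ(i)`, and by that of `j`
otherwise; what remains of the weights counts the crossings. -/
lemma permWt_eq : permWt σ = cr σ + invOn σ univ := by
  have hcr : cr σ = ∑ i, (#{j | (i < j ∧ j ≤ σ i) ∧ σ i < σ j} +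
      #{j | (σ i < σ j ∧ σ j < i) ∧ i < j}) := by
    unfold cr
    rw [card_filter_prod (fun i j => (i < j ∧ j ≤ σ i ∧ σ i < σ j) ∨
      (σ i < σ j ∧ σ j < i ∧ i < j))]
    refine Finset.sum_congr rfl fun i _ => ?_
    rw [Finset.filter_or, Finset.card_union_of_disjoint]
    · simp only [and_assoc]
    · rw [Finset.disjoint_filter]
      rintro j _ ⟨h1, h2, h3⟩ ⟨h4, h5, h6⟩
      exact absurd (h6.trans_le h2) (not_lt.2 (h4.trans h5).le)
  have hinv : invOn σ univ = ∑ i, (#{j | (i < j ∧ j ≤ σ i) ∧ ¬ σ i < σ j} +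
      #{j | (σ i < σ j ∧ σ j < i) ∧ ¬ i < j}) := by
    have h1 : invOn σ univ = #{p : Fin N × Fin N | (p.1 < p.2 ∧ p.2 ≤ σ p.1) ∧ ¬ σ p.1 < σ p.2} +
        #{p : Fin N × Fin N | (σ p.2 < σ p.1 ∧ σ p.1 < p.2) ∧ ¬ p.2 < p.1} := by
      rw [← Finset.card_union_of_disjoint]
      · unfold invOn
        congr 1
        ext ⟨i, j⟩
        simp only [mem_filter, univ_product_univ, mem_univ, true_and, mem_union]
        constructor
        · rintro ⟨h1, h2⟩
          rcases le_or_gt j (σ i) with h | h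
          exacts [Or.inl ⟨⟨h1, h⟩, not_lt.2 h2.le⟩, Or.inr ⟨⟨h2, h⟩, not_lt.2 h1.le⟩]
        · rintro (⟨⟨h1, h2⟩, h3⟩ | ⟨⟨h1, h2⟩, h3⟩)
          · exact ⟨h1, (not_lt.1 h3).lt_of_ne fun e => h1.ne (σ.injective e).symm⟩
          · exact ⟨(not_lt.1 h3).lt_of_ne fun e => h1.ne (by rw [e]), h1⟩
      · rw [Finset.disjoint_filter]
        rintro p _ ⟨⟨_, h1⟩, _⟩ ⟨⟨_, h2⟩, _⟩
        exact absurd h2 (not_lt.2 h1)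
    rw [h1, card_filter_prod (fun i j => (i < j ∧ j ≤ σ i) ∧ ¬ σ i < σ j),
      card_filter_prod_right (fun j i => (σ i < σ j ∧ σ j < i) ∧ ¬ i < j), Finset.sum_add_distrib]
  rw [hcr, hinv, permWt]
  push_cast
  rw [← Finset.sum_add_distrib]
  refine Finset.sum_congr rfl fun i _ => ?_
  rw [diffWeight_sub]
  rw [← Finset.card_filter_add_card_filter_not (s := ({j | i < j ∧ j ≤ σ i} : Finset (Fin N)))
      (fun j => σ i < σ j),
    ← Finset.card_filter_add_card_filter_not (s := ({j | σ i < σ j ∧ σ j < i} : Finset (Fin N)))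
      (fun j => i < j), Finset.filter_filter, Finset.filter_filter, Finset.filter_filter,
    Finset.filter_filter]
  push_cast
  ring

end Crossings

lemma diffWeight_nonneg (d : ℤ) : 0 ≤ diffWeight d := by
  unfold diffWeight; split_ifs <;> omega

namespace Matching

variable {N : ℕ}

lemma bwt_nonneg (ρ : Matching N) : 0 ≤ ρ.bwt := Finset.sum_nonneg fun _ _ => diffWeight_nonneg _

@[ext] lemma ext {ρ ρ' : Matching N} (h : ρ.edges = ρ'.edges) : ρ = ρ' := by
  cases ρ; cases ρ'; simpa using h

noncomputable instance : Fintype (Matching N) := Fintype.ofInjective Matching.edges fun _ _ => ext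

noncomputable instance : DecidableEq (Matching N) := Classical.decEq _

/-! ### Unmatched vertices -/

/-- The unmatched upper vertices. -/
def freeU (ρ : Matching N) : Finset (Fin N) := {j | ∀ e ∈ ρ.edges, e.1 ≠ j}

/-- The unmatched lower vertices. -/
def freeL (ρ : Matching N) : Finset (Fin N) := {j | ∀ e ∈ ρ.edges, e.2 ≠ j}

lemma mem_freeU {ρ : Matching N} {j : Fin N} : j ∈ ρ.freeU ↔ ∀ e ∈ ρ.edges, e.1 ≠ j := by
  simp [freeU]

lemma mem_freeL {ρ : Matching N} {j : Fin N} : j ∈ ρ.freeL ↔ ∀ e ∈ ρ.edges, e.2 ≠ j := by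
  simp [freeL]

lemma card_freeU_add (ρ : Matching N) : #ρ.freeU + #ρ.edges = N := by
  have h : #ρ.freeUᶜ = #ρ.edges := by
    symm
    refine Finset.card_bij (fun e _ => e.1) ?_ (fun e he f hf h => ρ.eq_of_upper e he f hf h) ?_
    · intro e he
      simp only [mem_compl, mem_freeU, not_forall, not_not]
      exact ⟨e, he, rfl⟩
    · intro j hj
      simpa [mem_freeU] using hj
  have := Finset.card_add_card_compl ρ.freeU
  rw [h, Fintype.card_fin] at this
  exact this

lemma card_freeL_add (ρ : Matching N) : #ρ.freeL + #ρ.edges = N := by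
  have h : #ρ.freeLᶜ = #ρ.edges := by
    symm
    refine Finset.card_bij (fun e _ => e.2) ?_ (fun e he f hf h => ρ.eq_of_lower e he f hf h) ?_
    · intro e he
      simp only [mem_compl, mem_freeL, not_forall, not_not]
      exact ⟨e, he, rfl⟩
    · intro j hj
      simpa [mem_freeL] using hj
  have := Finset.card_add_card_compl ρ.freeL
  rw [h, Fintype.card_fin] at this
  exact this

lemma bdiff_eq (ρ : Matching N) (e : Fin N × Fin N) :
    ρ.bdiff e = (#{j ∈ ρ.freeL | j < e.2} : ℤ) - #{j ∈ ρ.freeU | j < e.1} := by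
  have h1 : ({j : Fin N | j < e.2 ∧ ∀ f ∈ ρ.edges, f.2 ≠ j} : Finset (Fin N)) =
      {j ∈ ρ.freeL | j < e.2} := by
    ext j; simp only [mem_filter, mem_univ, true_and, mem_freeL, and_comm]
  have h2 : ({j : Fin N | j < e.1 ∧ ∀ f ∈ ρ.edges, f.1 ≠ j} : Finset (Fin N)) =
      {j ∈ ρ.freeU | j < e.1} := by
    ext j; simp only [mem_filter, mem_univ, true_and, mem_freeU, and_comm]
  rw [bdiff, bindL, bindU, h1, h2]
  push_cast
  ring

/-! ### Gluing matchings of the intervals -/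

section Glue

variable {k : ℕ} {n : Fin k → ℕ}

/-- The inclusion of the potential edges within the `r`-th interval. -/
def edgeIncl (n : Fin k → ℕ) (r : Fin k) :
    Fin (n r) × Fin (n r) ↪ Fin (∑ s, n s) × Fin (∑ s, n s) :=
  ⟨fun e => (emb n r e.1, emb n r e.2), fun e f h => by
    simp only [Prod.mk.injEq, emb_inj] at h
    exact Prod.ext h.1 h.2⟩

@[simp] lemma edgeIncl_apply (r : Fin k) (e : Fin (n r) × Fin (n r)) :
    edgeIncl n r e = (emb n r e.1, emb n r e.2) := rfl

/-- The matching of all of `[N]` consisting of given matchings of the intervals. -/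
def glue (p : ∀ s, Matching (n s)) : Matching (∑ s, n s) where
  edges := univ.biUnion fun s => (p s).edges.map (edgeIncl n s)
  eq_of_upper := by
    simp only [mem_biUnion, mem_map, mem_univ, true_and]
    rintro _ ⟨s, e, he, rfl⟩ _ ⟨t, f, hf, rfl⟩ h
    have hst : s = t := by simpa using congrArg (blk n) h
    subst hst
    rw [(p s).eq_of_upper e he f hf (by simpa using h)]
  eq_of_lower := by
    simp only [mem_biUnion, mem_map, mem_univ, true_and]
    rintro _ ⟨s, e, he, rfl⟩ _ ⟨t, f, hf, rfl⟩ h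
    have hst : s = t := by simpa using congrArg (blk n) h
    subst hst
    rw [(p s).eq_of_lower e he f hf (by simpa using h)]

lemma mem_glue {p : ∀ s, Matching (n s)} {e : Fin (∑ s, n s) × Fin (∑ s, n s)} :
    e ∈ (glue p).edges ↔ ∃ s, ∃ f ∈ (p s).edges, (emb n s f.1, emb n s f.2) = e := by
  simp only [glue, mem_biUnion, mem_map, mem_univ, true_and]
  rfl

lemma emb_mem_glue {p : ∀ s, Matching (n s)} {s : Fin k} {a b : Fin (n s)} :
    (emb n s a, emb n s b) ∈ (glue p).edges ↔ (a, b) ∈ (p s).edges := by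
  rw [mem_glue]
  refine ⟨?_, fun h => ⟨s, _, h, rfl⟩⟩
  rintro ⟨t, f, hf, h⟩
  rw [Prod.mk.injEq] at h
  have hst : t = s := by simpa using congrArg (blk n) h.1
  subst hst
  rw [emb_inj, emb_inj] at h
  rw [← h.1, ← h.2]
  exact hf

lemma sum_glue {M : Type*} [AddCommMonoid M] (p : ∀ s, Matching (n s))
    (F : Fin (∑ s, n s) × Fin (∑ s, n s) → M) :
    ∑ e ∈ (glue p).edges, F e = ∑ s, ∑ f ∈ (p s).edges, F (emb n s f.1, emb n s f.2) := by
  have h : (glue p).edges = univ.biUnion fun s => (p s).edges.map (edgeIncl n s) := rfl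
  rw [h, Finset.sum_biUnion]
  · refine Finset.sum_congr rfl fun s _ => ?_
    rw [Finset.sum_map]
    rfl
  · intro s _ t _ hst
    rw [Function.onFun, Finset.disjoint_left]
    simp only [mem_map, not_exists, not_and]
    rintro _ ⟨e, _, rfl⟩ f _ h
    exact hst (by simpa using (congrArg (fun e => blk n e.1) h).symm)

lemma card_glue (p : ∀ s, Matching (n s)) : #(glue p).edges = ∑ s, #(p s).edges := by
  simp only [Finset.card_eq_sum_ones, sum_glue]

lemma emb_mem_freeU_glue {p : ∀ s, Matching (n s)} {s : Fin k} {a : Fin (n s)} :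
    emb n s a ∈ (glue p).freeU ↔ a ∈ (p s).freeU := by
  simp only [mem_freeU, mem_glue]
  refine ⟨fun h e he hea => h _ ⟨s, e, he, rfl⟩ (by rw [hea]), ?_⟩
  rintro h _ ⟨t, e, he, rfl⟩ hh
  have hst : t = s := by simpa using congrArg (blk n) hh
  subst hst
  exact h e he (emb_inj.1 hh)

lemma emb_mem_freeL_glue {p : ∀ s, Matching (n s)} {s : Fin k} {a : Fin (n s)} :
    emb n s a ∈ (glue p).freeL ↔ a ∈ (p s).freeL := by
  simp only [mem_freeL, mem_glue]
  refine ⟨fun h e he hea => h _ ⟨s, e, he, rfl⟩ (by rw [hea]), ?_⟩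
  rintro h _ ⟨t, e, he, rfl⟩ hh
  have hst : t = s := by simpa using congrArg (blk n) hh
  subst hst
  exact h e he (emb_inj.1 hh)

lemma card_filter_emb (P : Fin (∑ s, n s) → Prop) [DecidablePred P] :
    #{j | P j} = ∑ s, #{a : Fin (n s) | P (emb n s a)} := by
  simp only [Finset.card_filter]
  rw [← (finSigmaFinEquiv (n := n)).sum_comp, Fintype.sum_sigma]
  rfl

/-- Gluing preserves block differences: in each interval there are as many unmatched upper as lower
vertices. -/
lemma bdiff_glue (p : ∀ s, Matching (n s)) {s : Fin k} (e : Fin (n s) × Fin (n s)) :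
    (glue p).bdiff (emb n s e.1, emb n s e.2) = (p s).bdiff e := by
  have hL : ({j ∈ (glue p).freeL | j < emb n s e.2} : Finset _) =
      ({j | j ∈ (glue p).freeL ∧ j < emb n s e.2} : Finset _) := by ext; simp
  have hU : ({j ∈ (glue p).freeU | j < emb n s e.1} : Finset _) =
      ({j | j ∈ (glue p).freeU ∧ j < emb n s e.1} : Finset _) := by ext; simp
  rw [bdiff_eq, bdiff_eq, hL, hU, card_filter_emb, card_filter_emb]
  push_cast
  rw [← Finset.sum_sub_distrib, Finset.sum_eq_single s]
  · simp only [emb_mem_freeL_glue, emb_mem_freeU_glue, emb_lt_emb]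
    congr 3 <;> ext <;> simp
  · intro t _ hts
    simp only [emb_mem_freeL_glue, emb_mem_freeU_glue]
    rcases hts.lt_or_gt with h | h
    · simp only [emb_lt_of_lt h, and_true, Finset.filter_mem_eq_inter, Finset.univ_inter]
      have := (p t).card_freeL_add
      have := (p t).card_freeU_add
      omega
    · have h' : ∀ a b, ¬ emb n t a < emb n s b := fun a b => not_lt.2 (emb_lt_of_lt h b a).le
      simp [h']
  · simp

lemma bwex_glue (p : ∀ s, Matching (n s)) : (glue p).bwex = ∑ s, (p s).bwex := by
  simp only [bwex, Finset.card_filter, sum_glue, bdiff_glue]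

lemma bwt_glue (p : ∀ s, Matching (n s)) : (glue p).bwt = ∑ s, (p s).bwt := by
  simp only [bwt, sum_glue, bdiff_glue]

lemma cross_glue (p : ∀ s, Matching (n s)) : (glue p).cross = ∑ s, (p s).cross := by
  simp only [cross, Finset.card_filter, Finset.sum_product, sum_glue]
  refine Finset.sum_congr rfl fun s _ => Finset.sum_congr rfl fun e _ => ?_
  rw [Finset.sum_eq_single s]
  · simp only [emb_lt_emb]
  · intro t _ hts
    refine Finset.sum_eq_zero fun f _ => if_neg ?_
    rintro ⟨h1, h2⟩
    rcases hts.lt_or_gt with h | h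
    · exact absurd h1 (not_lt.2 (emb_lt_of_lt h _ _).le)
    · exact absurd h2 (not_lt.2 (emb_lt_of_lt h _ _).le)
  · simp

variable (n) in
/-- Matchings all of whose edges are homogeneous. -/
abbrev HomMatching : Type :=
  {ρ : Matching (∑ s, n s) // ∀ e ∈ ρ.edges, Homogeneous n e.1 e.2}

lemma glue_homogeneous (p : ∀ s, Matching (n s)) :
    ∀ e ∈ (glue p).edges, Homogeneous n e.1 e.2 := by
  intro e he
  obtain ⟨s, f, _, rfl⟩ := mem_glue.1 he
  simp [homogeneous_iff]

/-- A matching with homogeneous edges decomposes uniquely into matchings of the intervals. -/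
lemma glue_bijective :
    Function.Bijective (fun p : ∀ s, Matching (n s) => (⟨glue p, glue_homogeneous p⟩ :
      HomMatching n)) := by
  constructor
  · intro p p' h
    have h' : (glue p) = glue p' := congrArg Subtype.val h
    funext s
    ext ⟨a, b⟩
    rw [← emb_mem_glue, ← emb_mem_glue, h']
  · rintro ⟨ρ, hρ⟩
    refine ⟨fun s => ⟨{e | (emb n s e.1, emb n s e.2) ∈ ρ.edges}, ?_, ?_⟩, ?_⟩
    · simp only [mem_filter, mem_univ, true_and]
      intro e he f hf hef
      have := ρ.eq_of_upper _ he _ hf (by simp [hef])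
      simp only [Prod.mk.injEq, emb_inj] at this
      exact Prod.ext this.1 this.2
    · simp only [mem_filter, mem_univ, true_and]
      intro e he f hf hef
      have := ρ.eq_of_lower _ he _ hf (by simp [hef])
      simp only [Prod.mk.injEq, emb_inj] at this
      exact Prod.ext this.1 this.2
    · apply Subtype.ext
      ext ⟨i, j⟩
      simp only [mem_glue, mem_filter, mem_univ, true_and, Prod.mk.injEq]
      constructor
      · rintro ⟨s, f, hf, rfl, rfl⟩
        exact hf
      · intro h
        have hb := homogeneous_iff.1 (hρ _ h)
        obtain ⟨s, a, rfl⟩ := exists_emb i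
        obtain ⟨t, b, rfl⟩ := exists_emb j
        have hst : s = t := by simpa using hb
        subst hst
        exact ⟨s, (a, b), h, rfl, rfl⟩

end Glue

end Matching

/-! ### Completing a homogeneous matching to a marked perfect matching -/

namespace MarkedPM

variable {k : ℕ} {n : Fin k → ℕ}

lemma unmarkedPortion_homogeneous (m : MarkedPM n) :
    ∀ e ∈ m.unmarkedPortion.edges, Homogeneous n e.1 e.2 := by
  intro e he
  obtain ⟨h1, h2⟩ := (m.mem_unmarkedPortion_edges e).1 he
  by_contra h
  exact h1 (m.2 e.1 (h2 ▸ h))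

/-- The unmarked portion, as a matching with homogeneous edges. -/
def unmarkedHom (m : MarkedPM n) : Matching.HomMatching n :=
  ⟨m.unmarkedPortion, m.unmarkedPortion_homogeneous⟩

lemma freeU_unmarkedPortion (m : MarkedPM n) : m.unmarkedPortion.freeU = m.marked := by
  ext i
  simp only [Matching.mem_freeU, mem_unmarkedPortion_edges]
  refine ⟨fun h => ?_, fun h e he hi => he.1 (hi ▸ h)⟩
  by_contra hi
  exact h (i, m.perm i) ⟨hi, rfl⟩ rfl

lemma freeL_unmarkedPortion (m : MarkedPM n) :
    m.unmarkedPortion.freeL = m.marked.map m.perm.toEmbedding := by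
  ext l
  simp only [Matching.mem_freeL, mem_unmarkedPortion_edges, mem_map, Equiv.coe_toEmbedding]
  constructor
  · intro h
    refine ⟨m.perm.symm l, ?_, by simp⟩
    by_contra hi
    exact h (m.perm.symm l, l) ⟨hi, by simp⟩ rfl
  · rintro ⟨i, hi, rfl⟩ e he h
    rw [← he.2] at h
    exact he.1 (m.perm.injective h ▸ hi)

/-- The marked portion, as a permutation of `Fin c` for `c` the number of marked edges. -/
def markedPortionCast (m : MarkedPM n) {c : ℕ} (h : #m.marked = c) : Equiv.Perm (Fin c) :=
  (finCongr h).permCongr m.markedPortion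

lemma wex_markedPortionCast (m : MarkedPM n) {c : ℕ} (h : #m.marked = c) :
    wex (m.markedPortionCast h) = wex m.markedPortion := by
  subst h; rfl

lemma cr_markedPortionCast (m : MarkedPM n) {c : ℕ} (h : #m.marked = c) :
    cr (m.markedPortionCast h) = cr m.markedPortion := by
  subst h; rfl

/-- The marked portion relabels `π` along the increasing enumerations of the marked endpoints. -/
lemma perm_orderEmbOfFin (m : MarkedPM n) {c : ℕ} (h : #m.marked = c)
    {U V : Finset (Fin (∑ s, n s))} (hU : m.marked = U) (hV : m.marked.map m.perm.toEmbedding = V)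
    (hUc : #U = c) (hVc : #V = c) (a : Fin c) :
    m.perm (U.orderEmbOfFin hUc a) = V.orderEmbOfFin hVc (m.markedPortionCast h a) := by
  subst hU hV h
  have hmem : m.perm (m.marked.orderEmbOfFin rfl a) ∈ m.marked.map m.perm.toEmbedding := by simp
  exact (congrArg Subtype.val (((m.marked.map m.perm.toEmbedding).orderIsoOfFin
    (card_map _)).apply_symm_apply ⟨_, hmem⟩)).symm

lemma markedPortionCast_injective {ρ : Matching (∑ s, n s)} {m m' : MarkedPM n}
    (hm : m.unmarkedPortion = ρ) (hm' : m'.unmarkedPortion = ρ) {c : ℕ} (h : #m.marked = c)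
    (h' : #m'.marked = c) (heq : m.markedPortionCast h = m'.markedPortionCast h') : m = m' := by
  have hU : m.marked = ρ.freeU := by rw [← hm, freeU_unmarkedPortion]
  have hU' : m'.marked = ρ.freeU := by rw [← hm', freeU_unmarkedPortion]
  have hV : m.marked.map m.perm.toEmbedding = ρ.freeL := by rw [← hm, freeL_unmarkedPortion]
  have hV' : m'.marked.map m'.perm.toEmbedding = ρ.freeL := by rw [← hm', freeL_unmarkedPortion]
  have hUc : #ρ.freeU = c := by rw [← hU, h]
  have hVc : #ρ.freeL = c := by rw [← hV, card_map, h]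
  refine Subtype.ext (Prod.ext ?_ (hU.trans hU'.symm))
  change m.perm = m'.perm
  ext1 i
  by_cases hi : i ∈ ρ.freeU
  · have : i ∈ Set.range (ρ.freeU.orderEmbOfFin hUc) := by
      rw [Finset.range_orderEmbOfFin]; exact hi
    obtain ⟨a, rfl⟩ := this
    rw [perm_orderEmbOfFin m h hU hV hUc hVc, perm_orderEmbOfFin m' h' hU' hV' hUc hVc, heq]
  · have h1 : (i, m.perm i) ∈ ρ.edges := by
      rw [← hm, mem_unmarkedPortion_edges, hU]
      exact ⟨hi, rfl⟩
    have h2 : (i, m'.perm i) ∈ ρ.edges := by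
      rw [← hm', mem_unmarkedPortion_edges, hU']
      exact ⟨hi, rfl⟩
    exact (Prod.mk.inj (ρ.eq_of_upper _ h1 _ h2 rfl)).2

/-- Any permutation of the unmatched vertices completes a homogeneous matching to a marked perfect
matching with that marked portion. -/
lemma exists_markedPortionCast (ρ : Matching.HomMatching n) {c : ℕ} (hUc : #ρ.1.freeU = c)
    (hVc : #ρ.1.freeL = c) (τ : Equiv.Perm (Fin c)) :
    ∃ m : MarkedPM n, m.unmarkedPortion = ρ.1 ∧
      ∃ h : #m.marked = c, m.markedPortionCast h = τ := by
  classical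
  obtain ⟨ρ, hρ⟩ := ρ
  simp only at hUc hVc ⊢
  have hpartner : ∀ i, ∃ j, i ∉ ρ.freeU → (i, j) ∈ ρ.edges := by
    intro i
    by_cases hi : i ∈ ρ.freeU
    · exact ⟨i, fun h => absurd hi h⟩
    · rw [Matching.mem_freeU] at hi
      push Not at hi
      obtain ⟨e, he, rfl⟩ := hi
      exact ⟨e.2, fun _ => he⟩
  choose g hg using hpartner
  let f : Fin (∑ s, n s) → Fin (∑ s, n s) := fun i =>
    if hi : i ∈ ρ.freeU then
      ρ.freeL.orderEmbOfFin hVc (τ ((ρ.freeU.orderIsoOfFin hUc).symm ⟨i, hi⟩))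
    else g i
  have hf1 : ∀ i (hi : i ∈ ρ.freeU), f i =
      ρ.freeL.orderEmbOfFin hVc (τ ((ρ.freeU.orderIsoOfFin hUc).symm ⟨i, hi⟩)) :=
    fun i hi => dif_pos hi
  have hf2 : ∀ i, i ∉ ρ.freeU → f i = g i := fun i hi => dif_neg hi
  have hf3 : ∀ i, i ∈ ρ.freeU → f i ∈ ρ.freeL := fun i hi => by
    rw [hf1 i hi]; exact Finset.orderEmbOfFin_mem _ _ _
  have hf4 : ∀ i, i ∉ ρ.freeU → f i ∉ ρ.freeL := fun i hi h => by
    rw [hf2 i hi] at h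
    exact Matching.mem_freeL.1 h _ (hg i hi) rfl
  have hinj : Function.Injective f := by
    intro i j hij
    by_cases hi : i ∈ ρ.freeU <;> by_cases hj : j ∈ ρ.freeU
    · rw [hf1 i hi, hf1 j hj, (ρ.freeL.orderEmbOfFin hVc).injective.eq_iff, τ.injective.eq_iff,
        (OrderIso.injective _).eq_iff] at hij
      exact congrArg Subtype.val hij
    · exact absurd (hf3 i hi) (hij ▸ hf4 j hj)
    · exact absurd (hf3 j hj) (hij ▸ hf4 i hi)
    · rw [hf2 i hi, hf2 j hj] at hij
      have := ρ.eq_of_lower _ (hg i hi) _ (hg j hj) hij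
      exact (Prod.mk.inj this).1
  let π : Equiv.Perm (Fin (∑ s, n s)) := Equiv.ofBijective f (Finite.injective_iff_bijective.1 hinj)
  have hπ : ∀ i, π i = f i := fun i => rfl
  let m : MarkedPM n := ⟨(π, ρ.freeU), fun i hi => by
    by_contra hn
    change i ∉ ρ.freeU at hn
    have h1 := hρ _ (hg i hn)
    refine hi ?_
    change Homogeneous n i (π i)
    rw [hπ, hf2 i hn]
    exact h1⟩
  have hm1 : m.marked = ρ.freeU := rfl
  have hm2 : ∀ i, m.perm i = f i := fun i => rfl
  have hum : m.unmarkedPortion = ρ := by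
    ext e
    rw [mem_unmarkedPortion_edges, hm1, hm2]
    constructor
    · rintro ⟨h1, h2⟩
      rw [hf2 _ h1] at h2
      have := hg _ h1
      rw [h2] at this
      exact this
    · intro he
      have h1 : e.1 ∉ ρ.freeU := fun h => Matching.mem_freeU.1 h e he rfl
      refine ⟨h1, ?_⟩
      rw [hf2 _ h1]
      exact congrArg Prod.snd (ρ.eq_of_upper _ (hg _ h1) _ he rfl)
  refine ⟨m, hum, hUc, ?_⟩
  ext1 a
  apply (ρ.freeL.orderEmbOfFin hVc).injective
  rw [← perm_orderEmbOfFin m hUc hm1 (by rw [← freeL_unmarkedPortion, hum]) hUc hVc, hm2,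
    hf1 _ (Finset.orderEmbOfFin_mem _ _ _)]
  congr 2
  rw [OrderIso.symm_apply_eq]
  exact Subtype.ext rfl

end MarkedPM

variable {R : Type*} [CommRing R] (q y : R)

/-! ### The moment functional and the matching polynomials -/

/-- The generating function of permutations by weak excedances and crossings. -/
def moment (N : ℕ) : R := ∑ σ : Equiv.Perm (Fin N), y ^ wex σ * q ^ cr σ

/-- The functional with moments `moment q y N`. -/
noncomputable def momentFunctional : R[X] →ₗ[R] R :=
  (Polynomial.basisMonomials R).constr R (moment q y)

lemma momentFunctional_C_mul_X_pow (a : R) (N : ℕ) :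
    momentFunctional q y (C a * X ^ N) = a * moment q y N := by
  have h : momentFunctional q y (monomial N 1) = moment q y N := by
    have := (Polynomial.basisMonomials R).constr_basis R (moment q y) N
    rwa [Polynomial.coe_basisMonomials] at this
  have h' : monomial N a = a • monomial N (1 : R) := by rw [smul_monomial, smul_eq_mul, mul_one]
  rw [C_mul_X_pow_eq_monomial, h', map_smul, h, smul_eq_mul]

/-- The signed weight of a matching. -/
def matchWeight {N : ℕ} (ρ : Matching N) : R :=
  (-1) ^ #ρ.edges * y ^ ρ.bwex * q ^ (ρ.bwt.toNat + ρ.cross)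

/-- The generating polynomial of the matchings of degree `N`, with `X` marking the pairs of
unmatched vertices. It turns out to be the `q`-Laguerre polynomial. -/
noncomputable def matchPoly (N : ℕ) : R[X] :=
  ∑ ρ : Matching N, C (matchWeight q y ρ) * X ^ #ρ.freeU

section Expansion

variable {k : ℕ} {n : Fin k → ℕ}

lemma matchWeight_glue (p : ∀ s, Matching (n s)) :
    matchWeight q y (Matching.glue p) = ∏ s, matchWeight q y (p s) := by
  have h : (Matching.glue p).bwt.toNat = ∑ s, (p s).bwt.toNat := by
    zify
    rw [Int.toNat_of_nonneg (Matching.bwt_nonneg _), Matching.bwt_glue]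
    exact Finset.sum_congr rfl fun s _ => (Int.toNat_of_nonneg (Matching.bwt_nonneg _)).symm
  simp only [matchWeight]
  rw [Finset.prod_mul_distrib, Finset.prod_mul_distrib, Finset.prod_pow_eq_pow_sum,
    Finset.prod_pow_eq_pow_sum, Finset.prod_pow_eq_pow_sum, Finset.sum_add_distrib, h,
    Matching.card_glue, Matching.bwex_glue, Matching.cross_glue]

lemma card_freeU_glue (p : ∀ s, Matching (n s)) :
    #(Matching.glue p).freeU = ∑ s, #(p s).freeU := by
  have h1 := (Matching.glue p).card_freeU_add
  have h2 : ∑ s, (#(p s).freeU + #(p s).edges) = ∑ s, n s :=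
    Finset.sum_congr rfl fun s _ => (p s).card_freeU_add
  rw [Finset.sum_add_distrib] at h2
  rw [Matching.card_glue] at h1
  omega

lemma prod_matchPoly :
    ∏ s, matchPoly q y (n s) =
      ∑ ρ : Matching.HomMatching n, C (matchWeight q y ρ.1) * X ^ #ρ.1.freeU := by
  simp only [matchPoly]
  rw [Fintype.prod_sum]
  refine Fintype.sum_bijective _ Matching.glue_bijective _ _ fun p => ?_
  rw [matchWeight_glue, card_freeU_glue, Finset.prod_mul_distrib, Finset.prod_pow_eq_pow_sum,
    map_prod]

/-- The completions of a homogeneous matching to a marked perfect matching are given by the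
permutations of the unmatched vertices. -/
lemma sum_fiber_unmarkedHom (ρ : Matching.HomMatching n) :
    ∑ m : MarkedPM n with m.unmarkedHom = ρ, y ^ wex m.markedPortion * q ^ cr m.markedPortion =
      moment q y #ρ.1.freeU := by
  have hcard : ∀ m : MarkedPM n, m ∈ ({m | m.unmarkedHom = ρ} : Finset (MarkedPM n)) →
      #m.marked = #ρ.1.freeU := by
    intro m hm
    rw [← (mem_filter.1 hm).2, MarkedPM.unmarkedHom, MarkedPM.freeU_unmarkedPortion]
  have hfree : #ρ.1.freeL = #ρ.1.freeU := by
    have h1 := ρ.1.card_freeU_add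
    have h2 := ρ.1.card_freeL_add
    omega
  refine Finset.sum_bij (fun m hm => m.markedPortionCast (hcard m hm)) (fun _ _ => mem_univ _)
    ?_ ?_ ?_
  · intro m hm m' hm' h
    exact MarkedPM.markedPortionCast_injective (congrArg Subtype.val (mem_filter.1 hm).2)
      (congrArg Subtype.val (mem_filter.1 hm').2) _ _ h
  · intro τ _
    obtain ⟨m, h1, h2, h3⟩ := MarkedPM.exists_markedPortionCast ρ rfl hfree τ
    exact ⟨m, mem_filter.2 ⟨mem_univ _, Subtype.ext h1⟩, h3⟩
  · intro m hm
    rw [MarkedPM.wex_markedPortionCast, MarkedPM.cr_markedPortionCast]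

namespace MarkedPM

lemma wt_add_cross_eq (m : MarkedPM n) : m.wt + m.cross =
    ((m.unmarkedPortion.bwt.toNat + m.unmarkedPortion.cross + cr m.markedPortion : ℕ) : ℤ) := by
  rw [wt, cross, permWt_eq, Matching.cross_ofPerm]
  push_cast
  rw [Int.toNat_of_nonneg (Matching.bwt_nonneg _)]
  ring

lemma wt_add_cross_nonneg (m : MarkedPM n) : 0 ≤ m.wt + m.cross := by
  rw [wt_add_cross_eq]
  positivity

/-- The weight of a marked perfect matching, without its sign. -/
def weight (m : MarkedPM n) : R := y ^ m.bwex * q ^ (m.wt + m.cross).toNat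

lemma matchWeight_mul (m : MarkedPM n) :
    matchWeight q y m.unmarkedPortion * (y ^ wex m.markedPortion * q ^ cr m.markedPortion) =
      (-1) ^ m.numEdges * m.weight q y := by
  rw [weight, wt_add_cross_eq, Int.toNat_natCast, matchWeight, bwex, numEdges, pow_add y,
    pow_add q _ (cr _)]
  ring

end MarkedPM

/-- Expanding the product and applying the functional gives the signed generating function of all
marked perfect matchings. -/
lemma momentFunctional_prod_eq_signed :
    momentFunctional q y (∏ s, matchPoly q y (n s)) =
      ∑ m : MarkedPM n, (-1) ^ m.numEdges * m.weight q y := by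
  rw [prod_matchPoly, map_sum, ← Finset.sum_fiberwise (g := MarkedPM.unmarkedHom)]
  refine Finset.sum_congr rfl fun ρ _ => ?_
  rw [momentFunctional_C_mul_X_pow, ← sum_fiber_unmarkedHom, Finset.mul_sum]
  refine Finset.sum_congr rfl fun m hm => ?_
  rw [← MarkedPM.matchWeight_mul, ← (mem_filter.1 hm).2]
  rfl

namespace MarkedPM

lemma weight_phi (m : MarkedPM n) : m.Phi.weight q y = m.weight q y := by
  rw [weight, weight, bwex_phi, wt_add_cross_phi]

lemma IsDerangement.marked_eq {m : MarkedPM n} (h : m.IsDerangement) : m.marked = univ :=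
  Finset.eq_univ_of_forall fun i => m.2 i (h i)

lemma sum_signed_eq :
    ∑ m : MarkedPM n, (-1) ^ m.numEdges * m.weight q y =
      ∑ m : MarkedPM n with m.IsDerangement, m.weight q y := by
  rw [← Finset.sum_filter_add_sum_filter_not univ (fun m : MarkedPM n => m.IsDerangement)]
  have h0 : ∑ m : MarkedPM n with ¬ m.IsDerangement, (-1) ^ m.numEdges * m.weight q y = 0 := by
    refine Finset.sum_involution (fun m _ => m.Phi) ?_ ?_ ?_ (fun m _ => m.phi_phi)
    · intro m hm
      have h1 : ((-1 : R)) ^ m.Phi.numEdges = -(-1) ^ m.numEdges := by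
        have := congrArg (Int.cast (R := R)) (neg_one_pow_numEdges_phi (mem_filter.1 hm).2)
        simpa using this
      rw [h1, weight_phi]
      ring
    · intro m hm _
      rw [Ne, phi_eq_self_iff]
      exact (mem_filter.1 hm).2
    · intro m hm
      rw [mem_filter] at hm ⊢
      refine ⟨mem_univ _, ?_⟩
      rw [← phi_eq_self_iff, phi_phi, eq_comm, phi_eq_self_iff]
      exact hm.2
  rw [h0, add_zero]
  refine Finset.sum_congr rfl fun m hm => ?_
  rw [numEdges_eq, (mem_filter.1 hm).2.marked_eq]
  simp

lemma bdiff_of_marked_eq_univ {m : MarkedPM n} (h : m.marked = univ) (i : Fin (∑ s, n s)) :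
    m.bdiff i = ((m.perm i : ℕ) : ℤ) - ((i : ℕ) : ℤ) := by
  have h1 : m.rankU i = i := by
    rw [rankU, h, ← Fin.card_Iio]
    congr 1
    ext j
    simp
  have h2 : m.rankL i = m.perm i := by
    rw [rankL, h, ← Fin.card_Iio]
    refine Finset.card_bij (fun j _ => m.perm j) (by simp) (fun a _ b _ h => m.perm.injective h) ?_
    intro b hb
    exact ⟨m.perm.symm b, by simpa using hb, by simp⟩
  rw [bdiff_eq, h1, h2]

lemma IsDerangement.weight_eq {m : MarkedPM n} (h : m.IsDerangement) :
    m.weight q y = y ^ wex m.perm * q ^ cr m.perm := by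
  have h1 := h.marked_eq
  have h2 : m.bwex = wex m.perm := by
    rw [bwex_eq, wex]
    congr 1
    ext i
    rw [mem_filter, mem_filter, bdiff_of_marked_eq_univ h1, Fin.le_def]
    simp
  have h3 : m.wt + m.cross = (cr m.perm : ℤ) := by
    have h4 : m.wt = permWt m.perm := by
      rw [wt_eq, permWt]
      simp only [bdiff_of_marked_eq_univ h1]
    rw [h4, permWt_eq, cross_eq, h1]
    simp [invOn]
  rw [weight, h2, h3, Int.toNat_natCast]

lemma sum_derangements_eq :
    ∑ m : MarkedPM n with m.IsDerangement, m.weight q y =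
      ∑ σ : Equiv.Perm (Fin (∑ s, n s)) with QLaguerre.IsDerangement n σ, y ^ wex σ * q ^ cr σ := by
  refine Finset.sum_bij (fun m _ => m.perm) ?_ ?_ ?_ ?_
  · intro m hm
    exact mem_filter.2 ⟨mem_univ _, (mem_filter.1 hm).2⟩
  · intro m hm m' hm' h
    exact Subtype.ext (Prod.ext h
      ((mem_filter.1 hm).2.marked_eq.trans (mem_filter.1 hm').2.marked_eq.symm))
  · intro σ hσ
    exact ⟨⟨(σ, univ), fun i _ => mem_univ _⟩,
      mem_filter.2 ⟨mem_univ _, (mem_filter.1 hσ).2⟩, rfl⟩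
  · intro m hm
    exact (mem_filter.1 hm).2.weight_eq q y

end MarkedPM

/-- The linearization formula for the matching polynomials and the moment functional. -/
theorem momentFunctional_prod :
    momentFunctional q y (∏ s, matchPoly q y (n s)) =
      ∑ σ : Equiv.Perm (Fin (∑ s, n s)) with IsDerangement n σ, y ^ wex σ * q ^ cr σ := by
  rw [momentFunctional_prod_eq_signed, MarkedPM.sum_signed_eq, MarkedPM.sum_derangements_eq]

end Expansion

/-! ### Orthogonality of the matching polynomials -/

lemma card_blk {k : ℕ} {n : Fin k → ℕ} (r : Fin k) : #{i | blk n i = r} = n r := by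
  rw [Matching.card_filter_emb, Finset.sum_eq_single r]
  · simp
  · intro s _ hs
    simp [hs]
  · simp

/-- For two intervals of different lengths there are no derangements, since a derangement would map
one interval onto the other. -/
lemma momentFunctional_mul_of_ne {a b : ℕ} (h : a ≠ b) :
    momentFunctional q y (matchPoly q y a * matchPoly q y b) = 0 := by
  have h1 := momentFunctional_prod q y (n := ![a, b])
  rw [Fin.prod_univ_two] at h1
  change momentFunctional q y (matchPoly q y a * matchPoly q y b) = _ at h1
  rw [h1]
  refine Finset.sum_eq_zero fun σ hσ => absurd ?_ h
  have hd := (mem_filter.1 hσ).2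
  have hblk : ∀ i, blk ![a, b] (σ i) = 0 ↔ blk ![a, b] i = 1 := by
    intro i
    have h2 : ¬ blk ![a, b] i = blk ![a, b] (σ i) := fun hh => hd i (homogeneous_iff.2 hh)
    have h3 : ∀ u v : Fin 2, u ≠ v → (v = 0 ↔ u = 1) := by decide
    exact h3 _ _ h2
  have ha : #{i | blk ![a, b] i = 0} = a := card_blk 0
  have hb : #{i | blk ![a, b] i = 1} = b := card_blk 1
  refine ha.symm.trans (Eq.trans (Eq.symm ?_) hb)
  refine Finset.card_bij (fun i _ => σ i) ?_ (fun i _ j _ h => σ.injective h) ?_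
  · intro i hi
    simpa [hblk] using hi
  · intro j hj
    refine ⟨σ.symm j, ?_, by simp⟩
    rw [mem_filter, ← hblk]
    simpa using hj

/-- Reversal is an `(a, a)`-derangement. -/
lemma isDerangement_rev (a : ℕ) : IsDerangement (fun _ : Fin 2 => a) Fin.revPerm := by
  intro i hi
  rw [homogeneous_iff] at hi
  have h0 : ∀ j, blk (fun _ : Fin 2 => a) j = 0 ↔ (j : ℕ) < a := by
    intro j
    rw [← inInterval_iff, InInterval]
    have e1 : Finset.Iio (0 : Fin 2) = ∅ := by decide
    have e2 : Finset.Iic (0 : Fin 2) = {0} := by decide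
    rw [e1, e2]
    simp
  have h1 := h0 i
  rw [hi, h0, Fin.revPerm_apply, Fin.val_rev] at h1
  have h2 := i.2
  simp only [Finset.sum_const, Finset.card_univ, Fintype.card_fin, smul_eq_mul] at h1 h2
  omega

/-- The norms of the matching polynomials do not vanish if `q = y = 1` is a specialization. -/
lemma momentFunctional_mul_self_ne_zero (φ : R →+* ℤ) (hq : φ q = 1) (hy : φ y = 1) (a : ℕ) :
    momentFunctional q y (matchPoly q y a * matchPoly q y a) ≠ 0 := by
  have h1 := momentFunctional_prod q y (n := fun _ : Fin 2 => a)
  rw [Fin.prod_univ_two] at h1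
  rw [h1]
  intro h
  have h2 := congrArg φ h
  simp only [map_sum, map_mul, map_pow, hq, hy, one_pow, mul_one, map_zero, Finset.sum_const,
    nsmul_eq_mul, Nat.cast_eq_zero, Finset.card_eq_zero] at h2
  exact Finset.notMem_empty _ (h2 ▸ mem_filter.2 ⟨mem_univ _, isDerangement_rev a⟩)

/-! ### Inversions and `q`-factorials -/

section Mahonian

/-- The permutation with first value `p` whose remaining values are arranged as in `τ`. -/
noncomputable def insPerm {N : ℕ} (p : Fin (N + 1)) (τ : Equiv.Perm (Fin N)) :
    Equiv.Perm (Fin (N + 1)) :=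
  Equiv.ofBijective (Fin.cons p fun i => p.succAbove (τ i) : Fin (N + 1) → Fin (N + 1))
    (Finite.injective_iff_bijective.1 (Fin.cons_injective_iff.2
      ⟨fun ⟨_, hi⟩ => Fin.succAbove_ne _ _ hi,
        Fin.succAbove_right_injective.comp τ.injective⟩))

@[simp] lemma insPerm_zero {N : ℕ} (p : Fin (N + 1)) (τ : Equiv.Perm (Fin N)) :
    insPerm p τ 0 = p := rfl

@[simp] lemma insPerm_succ {N : ℕ} (p : Fin (N + 1)) (τ : Equiv.Perm (Fin N)) (i : Fin N) :
    insPerm p τ i.succ = p.succAbove (τ i) := rfl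

lemma insPerm_bijective (N : ℕ) :
    Function.Bijective (fun x : Fin (N + 1) × Equiv.Perm (Fin N) => insPerm x.1 x.2) := by
  rw [Fintype.bijective_iff_injective_and_card]
  constructor
  · rintro ⟨p, τ⟩ ⟨p', τ'⟩ h
    simp only at h
    have hp : p = p' := by simpa using DFunLike.congr_fun h 0
    subst hp
    have hτ : τ = τ' := by
      ext1 i
      have := DFunLike.congr_fun h i.succ
      simpa using this
    rw [hτ]
  · rw [Fintype.card_prod, Fintype.card_perm, Fintype.card_perm, Fintype.card_fin,
      Fintype.card_fin, Nat.factorial_succ]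

lemma invOn_insPerm {N : ℕ} (p : Fin (N + 1)) (τ : Equiv.Perm (Fin N)) :
    invOn (insPerm p τ) univ = p + invOn τ univ := by
  have h1 : ∀ {N : ℕ} (σ : Equiv.Perm (Fin N)),
      invOn σ univ = ∑ a, ∑ b, if a < b ∧ σ b < σ a then 1 else 0 := by
    intro N σ
    rw [invOn, univ_product_univ, card_filter_prod (fun a b => a < b ∧ σ b < σ a)]
    simp only [Finset.card_filter]
  have h2 : ∑ b, (if τ b < p.val then 1 else 0 : ℕ) = p := by
    rw [Equiv.sum_comp τ (fun b : Fin N => if b.val < p.val then 1 else 0), ← Finset.card_filter,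
      Fin.card_filter_val_lt]
    exact min_eq_right (Nat.lt_succ_iff.1 p.2)
  rw [h1, h1, Fin.sum_univ_succ]
  congr 1
  · rw [Fin.sum_univ_succ]
    simp only [lt_irrefl, false_and, if_false, zero_add, Fin.succ_pos, true_and, insPerm_zero,
      insPerm_succ, Fin.succAbove_lt_iff_castSucc_lt]
    exact h2
  · refine Finset.sum_congr rfl fun a _ => ?_
    rw [Fin.sum_univ_succ]
    simp [Fin.succ_lt_succ_iff]

/-- The inversion generating function of permutations is the `q`-factorial. -/
lemma sum_pow_invOn_succ {R : Type*} [CommRing R] (q : R) (N : ℕ) :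
    ∑ σ : Equiv.Perm (Fin (N + 1)), q ^ invOn σ univ =
      qNum q (N + 1) * ∑ σ : Equiv.Perm (Fin N), q ^ invOn σ univ := by
  rw [← (insPerm_bijective N).sum_comp (fun σ => q ^ invOn σ univ), Fintype.sum_prod_type, qNum,
    Finset.sum_mul, Finset.sum_range]
  refine Finset.sum_congr rfl fun p _ => ?_
  rw [Finset.mul_sum]
  exact Finset.sum_congr rfl fun τ _ => by rw [invOn_insPerm, pow_add]

end Mahonian

variable {R : Type*} [CommRing R] (q y : R)

/-! ### Coefficients of the matching polynomials -/

lemma coeff_matchPoly (N j : ℕ) :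
    (matchPoly q y N).coeff j = ∑ ρ : Matching N with #ρ.freeU = j, matchWeight q y ρ := by
  rw [matchPoly, finsetSum_coeff, Finset.sum_filter]
  refine Finset.sum_congr rfl fun ρ _ => ?_
  rw [coeff_C_mul_X_pow]
  simp only [eq_comm]

lemma coeff_matchPoly_of_lt {N j : ℕ} (h : N < j) : (matchPoly q y N).coeff j = 0 := by
  rw [coeff_matchPoly]
  refine Finset.sum_eq_zero fun ρ hρ => ?_
  have := ρ.card_freeU_add
  have := (mem_filter.1 hρ).2
  omega

lemma coeff_matchPoly_self (N : ℕ) : (matchPoly q y N).coeff N = 1 := by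
  let ρ₀ : Matching N := ⟨∅, by simp, by simp⟩
  have hmem : ∀ ρ : Matching N, #ρ.freeU = N ↔ ρ = ρ₀ := by
    intro ρ
    have := ρ.card_freeU_add
    constructor
    · intro h
      ext1
      exact Finset.card_eq_zero.1 (by omega)
    · rintro rfl
      simpa [ρ₀] using this
  rw [coeff_matchPoly]
  simp only [hmem]
  rw [Finset.filter_eq' univ ρ₀, if_pos (mem_univ _), Finset.sum_singleton]
  simp [matchWeight, ρ₀, Matching.bwex, Matching.bwt, Matching.cross]

/-- The contribution of an edge with block difference `d`. -/
def edgeWeight (d : ℤ) : R := y ^ (if 0 ≤ d then 1 else 0) * q ^ (diffWeight d).toNat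

/-- The matching with a single edge. -/
def singleEdge {N : ℕ} (e : Fin N × Fin N) : Matching N where
  edges := {e}
  eq_of_upper := by simp +contextual
  eq_of_lower := by simp +contextual

lemma matchWeight_singleEdge {N : ℕ} (e : Fin N × Fin N) :
    matchWeight q y (singleEdge e) = -edgeWeight q y (((e.2 : ℕ) : ℤ) - ((e.1 : ℕ) : ℤ)) := by
  have hb : (singleEdge e).bdiff e = ((e.2 : ℕ) : ℤ) - ((e.1 : ℕ) : ℤ) := by
    rw [Matching.bdiff_eq]
    have h1 : ({j ∈ (singleEdge e).freeL | j < e.2} : Finset _) = Finset.Iio e.2 := by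
      ext j
      simp only [mem_filter, Matching.mem_freeL, singleEdge, mem_singleton, forall_eq,
        Finset.mem_Iio]
      exact ⟨fun h => h.2, fun h => ⟨h.ne', h⟩⟩
    have h2 : ({j ∈ (singleEdge e).freeU | j < e.1} : Finset _) = Finset.Iio e.1 := by
      ext j
      simp only [mem_filter, Matching.mem_freeU, singleEdge, mem_singleton, forall_eq,
        Finset.mem_Iio]
      exact ⟨fun h => h.2, fun h => ⟨h.ne', h⟩⟩
    rw [h1, h2, Fin.card_Iio, Fin.card_Iio]
  have he : (singleEdge e).edges = {e} := rfl
  have hc : (singleEdge e).cross = 0 := by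
    rw [Matching.cross, he]
    simp
  rw [matchWeight, Matching.bwex, Matching.bwt, hc, he, Finset.filter_singleton, hb,
    Finset.sum_singleton, hb, edgeWeight]
  split_ifs <;> simp

lemma coeff_matchPoly_succ (N : ℕ) : (matchPoly q y (N + 1)).coeff N =
    -∑ i : Fin (N + 1), ∑ j : Fin (N + 1), edgeWeight q y (((j : ℕ) : ℤ) - ((i : ℕ) : ℤ)) := by
  rw [coeff_matchPoly, ← Fintype.sum_prod_type', ← Finset.sum_neg_distrib]
  symm
  refine Finset.sum_bij (fun e _ => singleEdge e) ?_ ?_ ?_ ?_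
  · intro e _
    have := (singleEdge e).card_freeU_add
    rw [show #(singleEdge e).edges = 1 from rfl] at this
    exact mem_filter.2 ⟨mem_univ _, by omega⟩
  · intro e _ f _ h
    exact Finset.singleton_injective (congrArg Matching.edges h)
  · intro ρ hρ
    have h1 := ρ.card_freeU_add
    have h2 := (mem_filter.1 hρ).2
    obtain ⟨e, he⟩ := Finset.card_eq_one.1 (show #ρ.edges = 1 by omega)
    exact ⟨e, mem_univ _, Matching.ext he.symm⟩
  · intro e _
    rw [matchWeight_singleEdge]

lemma coeff_matchPoly_succ_succ (N : ℕ) : (matchPoly q y (N + 2)).coeff (N + 1) =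
    (matchPoly q y (N + 1)).coeff N - (y * qNum q (N + 2) + qNum q (N + 1)) := by
  rw [coeff_matchPoly_succ, coeff_matchPoly_succ, Fin.sum_univ_castSucc]
  simp only [Fin.sum_univ_castSucc (n := N + 1), Finset.sum_add_distrib, Fin.val_castSucc,
    Fin.val_last]
  have h1 : ∑ i : Fin (N + 1), edgeWeight q y (((N + 1 : ℕ) : ℤ) - ((i : ℕ) : ℤ)) +
      edgeWeight q y (((N + 1 : ℕ) : ℤ) - ((N + 1 : ℕ) : ℤ)) = y * qNum q (N + 2) := by
    have h2 : ∀ i : ℕ, i ≤ N + 1 → edgeWeight q y (((N + 1 : ℕ) : ℤ) - (i : ℤ)) =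
        y * q ^ (N + 1 - i) := by
      intro i hi
      have h3 : ((N + 1 : ℕ) : ℤ) - (i : ℤ) = ((N + 1 - i : ℕ) : ℤ) := by omega
      rw [h3, edgeWeight, diffWeight, if_pos (Int.natCast_nonneg _),
        if_pos (Int.natCast_nonneg _), Int.toNat_natCast, pow_one]
    rw [Finset.sum_congr rfl fun (i : Fin (N + 1)) _ => h2 i (by omega), h2 (N + 1) le_rfl, qNum,
      Finset.mul_sum, ← Finset.sum_range_reflect, Finset.sum_range_succ, Finset.sum_range]
    rfl
  have h2 : ∑ j : Fin (N + 1), edgeWeight q y (((j : ℕ) : ℤ) - ((N + 1 : ℕ) : ℤ)) =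
      qNum q (N + 1) := by
    rw [qNum, ← Finset.sum_range_reflect, Finset.sum_range]
    refine Finset.sum_congr rfl fun j _ => ?_
    have hj := j.2
    rw [edgeWeight, diffWeight, if_neg (by omega), if_neg (by omega), pow_zero, one_mul]
    congr 1
    omega
  rw [h2, ← h1]
  ring

lemma matchWeight_ofPerm {N : ℕ} (σ : Equiv.Perm (Fin N)) :
    matchWeight q y (Matching.ofPerm σ univ) = (-1) ^ N * y ^ N * q ^ invOn σ univ := by
  have hmem : ∀ i, (i, σ i) ∈ (Matching.ofPerm σ univ).edges := fun i => by simp [Matching.ofPerm]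
  have hU : (Matching.ofPerm σ univ).freeU = ∅ :=
    Finset.eq_empty_of_forall_notMem fun i hi => Matching.mem_freeU.1 hi _ (hmem i) rfl
  have hL : (Matching.ofPerm σ univ).freeL = ∅ :=
    Finset.eq_empty_of_forall_notMem fun i hi =>
      Matching.mem_freeL.1 hi _ (hmem (σ.symm i)) (by simp)
  have hb : ∀ e, (Matching.ofPerm σ univ).bdiff e = 0 := fun e => by
    rw [Matching.bdiff_eq, hU, hL]; simp
  have hc : #(Matching.ofPerm σ univ).edges = N := by
    have := (Matching.ofPerm σ univ).card_freeU_add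
    rw [hU] at this
    simpa using this
  rw [matchWeight, Matching.cross_ofPerm, Matching.bwex, Matching.bwt]
  simp only [hb, le_refl, Finset.filter_true, hc]
  simp [diffWeight]

/-- In the constant coefficient only the perfect matchings contribute, and all their block
differences vanish. -/
lemma coeff_zero_matchPoly (N : ℕ) : (matchPoly q y N).coeff 0 =
    (-1) ^ N * y ^ N * ∑ σ : Equiv.Perm (Fin N), q ^ invOn σ univ := by
  rw [coeff_matchPoly, Finset.mul_sum]
  symm
  refine Finset.sum_bij (fun σ _ => Matching.ofPerm σ univ) ?_ ?_ ?_ ?_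
  · intro σ _
    refine mem_filter.2 ⟨mem_univ _, Finset.card_eq_zero.2 ?_⟩
    exact Finset.eq_empty_of_forall_notMem fun i hi =>
      Matching.mem_freeU.1 hi (i, σ i) (by simp [Matching.ofPerm]) rfl
  · intro σ _ τ _ h
    ext1 i
    have h1 : (i, σ i) ∈ (Matching.ofPerm τ univ).edges := by
      rw [← h]; simp [Matching.ofPerm]
    simpa [Matching.ofPerm, eq_comm] using h1
  · intro ρ hρ
    have hU := Finset.card_eq_zero.1 (mem_filter.1 hρ).2
    have hex : ∀ i, ∃ j, (i, j) ∈ ρ.edges := by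
      intro i
      have hi : i ∉ ρ.freeU := by simp [hU]
      rw [Matching.mem_freeU] at hi
      push Not at hi
      obtain ⟨e, he, rfl⟩ := hi
      exact ⟨e.2, he⟩
    choose f hf using hex
    have hinj : Function.Injective f := fun i j hij =>
      (Prod.mk.inj (ρ.eq_of_lower _ (hf i) _ (hf j) hij)).1
    refine ⟨Equiv.ofBijective f (Finite.injective_iff_bijective.1 hinj), mem_univ _, ?_⟩
    ext e
    simp only [Matching.ofPerm, mem_image, mem_univ, true_and, Equiv.ofBijective_apply]
    constructor
    · rintro ⟨i, rfl⟩
      exact hf i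
    · intro he
      exact ⟨e.1, ρ.eq_of_upper _ (hf e.1) _ he rfl⟩
  · intro σ _
    rw [matchWeight_ofPerm]

/-! ### Orthogonal polynomials -/

section Orthogonal

/-- A sequence of monic polynomials with one polynomial in each degree spans all polynomials. -/
lemma exists_expansion {M : ℕ → R[X]} (h1 : ∀ n, (M n).coeff n = 1)
    (h0 : ∀ n j, n < j → (M n).coeff j = 0) (d : ℕ) (p : R[X]) (hp : ∀ j, d ≤ j → p.coeff j = 0) :
    ∃ a : ℕ → R, p = ∑ i ∈ range d, C (a i) * M i := by
  induction d generalizing p with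
  | zero => exact ⟨0, by ext j; simpa using hp j (Nat.zero_le _)⟩
  | succ d ih =>
    obtain ⟨a, ha⟩ := ih (p - C (p.coeff d) * M d) fun j hj => by
      rw [coeff_sub, coeff_C_mul]
      rcases hj.eq_or_lt with rfl | hj
      · rw [h1]; ring
      · rw [h0 _ _ hj, hp j hj]; ring
    refine ⟨fun i => if i = d then p.coeff d else a i, ?_⟩
    simp only [Finset.sum_range_succ, if_true]
    rw [← sub_eq_iff_eq_add, ha]
    refine Finset.sum_congr rfl fun i hi => ?_
    rw [if_neg (Finset.mem_range.1 hi).ne]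

lemma map_C_mul (ℒ : R[X] →ₗ[R] R) (a : R) (p : R[X]) : ℒ (C a * p) = a * ℒ p := by
  rw [← smul_eq_C_mul, map_smul, smul_eq_mul]

/-- Monic orthogonal polynomials with nonzero norms satisfy a three-term recurrence. -/
lemma exists_recurrence [IsDomain R] {M : ℕ → R[X]} (h1 : ∀ n, (M n).coeff n = 1)
    (h0 : ∀ n j, n < j → (M n).coeff j = 0) (ℒ : R[X] →ₗ[R] R)
    (horth : ∀ m n, m ≠ n → ℒ (M m * M n) = 0) (hnorm : ∀ n, ℒ (M n * M n) ≠ 0) (n : ℕ) :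
    ∃ b c : R, M (n + 2) = (X - C b) * M (n + 1) - C c * M n := by
  have horth' : ∀ d (p : R[X]), (∀ j, d ≤ j → p.coeff j = 0) → ℒ (M d * p) = 0 := by
    intro d p hp
    obtain ⟨a, rfl⟩ := exists_expansion h1 h0 d p hp
    rw [Finset.mul_sum, map_sum]
    refine Finset.sum_eq_zero fun i hi => ?_
    rw [mul_left_comm, map_C_mul, horth _ _ (Finset.mem_range.1 hi).ne', mul_zero]
  have hX : ∀ d j, (X * M d).coeff j = if j = 0 then 0 else (M d).coeff (j - 1) := by
    intro d j
    cases j with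
    | zero => simp
    | succ j => simp [coeff_X_mul]
  -- the leading terms cancel, and only the two top terms of the expansion survive
  obtain ⟨a, ha⟩ := exists_expansion h1 h0 (n + 2) (M (n + 2) - X * M (n + 1)) fun j hj => by
    rw [coeff_sub, hX, if_neg (by omega)]
    rcases hj.eq_or_lt with rfl | hj
    · rw [h1, show n + 2 - 1 = n + 1 by omega, h1, sub_self]
    · rw [h0 _ _ hj, h0 _ _ (by omega), sub_self]
  have hzero : ∀ j, j < n → a j = 0 := by
    intro j hj
    have e1 : ℒ ((M (n + 2) - X * M (n + 1)) * M j) = 0 := by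
      rw [sub_mul, map_sub, horth _ _ (by omega), mul_right_comm, mul_comm,
        horth' (n + 1) _ fun i hi => ?_, sub_zero]
      rw [hX, if_neg (by omega), h0 _ _ (by omega)]
    rw [ha, Finset.sum_mul, map_sum, Finset.sum_eq_single j] at e1
    · rw [mul_assoc, map_C_mul] at e1
      exact (mul_eq_zero.1 e1).resolve_right (hnorm j)
    · intro i _ hij
      rw [mul_assoc, map_C_mul, horth _ _ hij, mul_zero]
    · intro hj'
      exact absurd (Finset.mem_range.2 (by omega)) hj'
  refine ⟨-a (n + 1), -a n, ?_⟩
  rw [Finset.sum_range_succ, Finset.sum_range_succ, Finset.sum_eq_zero fun i hi => by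
    rw [hzero i (Finset.mem_range.1 hi), C_0, zero_mul]] at ha
  rw [sub_eq_iff_eq_add] at ha
  rw [ha, C_neg, C_neg]
  ring

end Orthogonal

/-! ### The matching polynomials are the `q`-Laguerre polynomials -/

lemma matchPoly_zero : matchPoly q y 0 = 1 := by
  ext j
  rcases Nat.eq_zero_or_pos j with rfl | hj
  · simp [coeff_matchPoly_self]
  · rw [coeff_matchPoly_of_lt q y hj, coeff_one, if_neg hj.ne']

lemma matchPoly_one : matchPoly q y 1 = X - C y := by
  ext j
  rcases lt_trichotomy j 1 with hj | rfl | hj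
  · obtain rfl : j = 0 := by omega
    have h : ∀ σ : Equiv.Perm (Fin 1), invOn σ univ = 0 := fun σ =>
      Finset.card_eq_zero.2 (Finset.filter_false_of_mem fun p _ hp =>
        hp.1.ne (Subsingleton.elim _ _))
    rw [coeff_zero_matchPoly]
    simp only [h]
    simp
  · rw [coeff_matchPoly_self]
    simp
  · rw [coeff_matchPoly_of_lt q y hj, coeff_sub, coeff_X, coeff_C, if_neg hj.ne,
      if_neg (by omega), sub_zero]

/-- In a domain with the specialization `q = y = 1`, the three-term recurrence follows from
orthogonality, and its coefficients are determined by the two extreme coefficients of the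
matching polynomials. -/
lemma matchPoly_eq_of_isDomain [IsDomain R] (φ : R →+* ℤ) (hq : φ q = 1) (hy : φ y = 1) (n : ℕ) :
    matchPoly q y n = qLaguerre q y n := by
  have hfact : ∀ n, y ^ n * ∑ σ : Equiv.Perm (Fin n), q ^ invOn σ univ ≠ 0 := by
    intro n h
    have h2 := congrArg φ h
    simp [hq, hy, Fintype.card_perm, Nat.factorial_ne_zero] at h2
  have hrec : ∀ n, matchPoly q y (n + 2) =
      (X - C (y * qNum q (n + 2)) - C (qNum q (n + 1))) * matchPoly q y (n + 1) -
        C (y * qNum q (n + 1) ^ 2) * matchPoly q y n := by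
    intro n
    obtain ⟨b, c, h⟩ := exists_recurrence (coeff_matchPoly_self q y)
      (fun n j => coeff_matchPoly_of_lt q y) (momentFunctional q y)
      (fun m n => momentFunctional_mul_of_ne q y)
      (momentFunctional_mul_self_ne_zero q y φ hq hy) n
    have hb : b = y * qNum q (n + 2) + qNum q (n + 1) := by
      have h2 := congrArg (fun p : R[X] => p.coeff (n + 1)) h
      simp only [sub_mul, coeff_sub, coeff_C_mul, coeff_X_mul, coeff_matchPoly_self,
        coeff_matchPoly_succ_succ, coeff_matchPoly_of_lt q y (Nat.lt_succ_self n)] at h2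
      linear_combination h2
    have hc : c = y * qNum q (n + 1) ^ 2 := by
      have h2 := congrArg (fun p : R[X] => p.coeff 0) h
      simp only [sub_mul, coeff_sub, coeff_C_mul, coeff_X_mul_zero, coeff_zero_matchPoly,
        sum_pow_invOn_succ, hb] at h2
      have h3 : (y ^ n * ∑ σ : Equiv.Perm (Fin n), q ^ invOn σ univ) *
          (c - y * qNum q (n + 1) ^ 2) = 0 := by
        have h4 : ((-1 : R) ^ n) * (-1) ^ n = 1 := by rw [← mul_pow]; simp
        linear_combination ((-1 : R) ^ n) * h2 + (y ^ n *
          (∑ σ : Equiv.Perm (Fin n), q ^ invOn σ univ) * (c - y * qNum q (n + 1) ^ 2)) * (-h4)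
      exact sub_eq_zero.1 ((mul_eq_zero.1 h3).resolve_left (hfact n))
    rw [h, hb, hc, C_add]
    ring
  induction n using Nat.twoStepInduction with
  | zero => exact matchPoly_zero q y
  | one => exact matchPoly_one q y
  | more n ih1 ih2 => rw [hrec, ih1, ih2, qLaguerre]

lemma map_matchPoly {S : Type*} [CommRing S] (φ : R →+* S) (n : ℕ) :
    (matchPoly q y n).map φ = matchPoly (φ q) (φ y) n := by
  simp [matchPoly, matchWeight, Polynomial.map_sum]

lemma map_qLaguerre {S : Type*} [CommRing S] (φ : R →+* S) (n : ℕ) :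
    (qLaguerre q y n).map φ = qLaguerre (φ q) (φ y) n := by
  have hnum : ∀ n, φ (qNum q n) = qNum (φ q) n := fun n => by simp [qNum]
  induction n using Nat.twoStepInduction with
  | zero => simp [qLaguerre]
  | one => simp [qLaguerre]
  | more n ih1 ih2 => simp [qLaguerre, ih1, ih2, hnum]

/-- The identity over an arbitrary ring is a specialization of the one over `ℤ[q, y]`. -/
theorem matchPoly_eq_qLaguerre (n : ℕ) : matchPoly q y n = qLaguerre q y n := by
  have h := matchPoly_eq_of_isDomain (R := MvPolynomial (Fin 2) ℤ) (MvPolynomial.X 0)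
    (MvPolynomial.X 1) (MvPolynomial.eval fun _ => 1) (by simp) (by simp) n
  have h2 := congrArg (Polynomial.map (MvPolynomial.eval₂Hom (Int.castRingHom R) ![q, y])) h
  rw [map_matchPoly, map_qLaguerre] at h2
  simpa using h2

/-! ### The linear functional -/

lemma isLaguerreFunctional_momentFunctional :
    IsLaguerreFunctional q y (momentFunctional q y) where
  map_one := by
    have h := momentFunctional_C_mul_X_pow q y 1 0
    have h0 : moment q y 0 = 1 := by simp [moment, wex, cr]
    simpa [h0] using h
  orthogonal m n h := by
    rw [← matchPoly_eq_qLaguerre, ← matchPoly_eq_qLaguerre]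
    exact momentFunctional_mul_of_ne q y h

lemma IsLaguerreFunctional.eq_momentFunctional {ℒ : R[X] →ₗ[R] R}
    (h : IsLaguerreFunctional q y ℒ) : ℒ = momentFunctional q y := by
  have h' := isLaguerreFunctional_momentFunctional q y
  have hL : ∀ i, ℒ (qLaguerre q y i) = momentFunctional q y (qLaguerre q y i) := by
    intro i
    rcases Nat.eq_zero_or_pos i with rfl | hi
    · rw [qLaguerre, h.map_one, h'.map_one]
    · have e1 := h.orthogonal i 0 hi.ne'
      have e2 := h'.orthogonal i 0 hi.ne'
      rw [qLaguerre, mul_one] at e1 e2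
      rw [e1, e2]
  refine LinearMap.ext fun p => ?_
  obtain ⟨a, ha⟩ := exists_expansion (M := matchPoly q y) (coeff_matchPoly_self q y)
    (fun n j => coeff_matchPoly_of_lt q y) (p.natDegree + 1) p
    fun j hj => coeff_eq_zero_of_natDegree_lt hj
  rw [ha, map_sum, map_sum]
  refine Finset.sum_congr rfl fun i _ => ?_
  rw [map_C_mul, map_C_mul, matchPoly_eq_qLaguerre, hL]

end QLaguerre

theorem mainTheorem1 {R : Type*} [CommRing R] (q y : R) :
    (∃! 𝓛 : R[X] →ₗ[R] R, QLaguerre.IsLaguerreFunctional q y 𝓛) ∧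
    ∀ (k : ℕ) (n : Fin k → ℕ), (∀ s, 0 < n s) →
      -- the linearization formula, over derangements as permutations
      (∀ 𝓛 : R[X] →ₗ[R] R, QLaguerre.IsLaguerreFunctional q y 𝓛 →
        𝓛 (∏ s, QLaguerre.qLaguerre q y (n s)) =
          ∑ σ : Equiv.Perm (Fin (∑ s, n s)) with QLaguerre.IsDerangement n σ,
            y ^ QLaguerre.wex σ * q ^ QLaguerre.cr σ) ∧
      -- the same, over derangements as marked perfect matchings
      (∀ m : QLaguerre.MarkedPM n, 0 ≤ m.wt + m.cross) ∧
      (∀ 𝓛 : R[X] →ₗ[R] R, QLaguerre.IsLaguerreFunctional q y 𝓛 →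
        𝓛 (∏ s, QLaguerre.qLaguerre q y (n s)) =
          ∑ m : QLaguerre.MarkedPM n with m.IsDerangement,
            y ^ m.bwex * q ^ (m.wt + m.cross).toNat) ∧
      -- the sign-reversing involution
      (∀ m : QLaguerre.MarkedPM n, m.Phi.Phi = m) ∧
      (∀ m : QLaguerre.MarkedPM n, m.Phi = m ↔ m.IsDerangement) ∧
      (∀ m : QLaguerre.MarkedPM n, ¬ m.IsDerangement →
        (∃ i, m.Convertible i ∧ m.Phi.perm = m.perm ∧ m.Phi.marked = symmDiff m.marked {i}) ∧
        (-1 : ℤ) ^ m.Phi.numEdges = -(-1) ^ m.numEdges) ∧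
      (∀ m : QLaguerre.MarkedPM n,
        m.Phi.bwex = m.bwex ∧ m.Phi.wt + m.Phi.cross = m.wt + m.cross) := by
  refine ⟨⟨QLaguerre.momentFunctional q y, QLaguerre.isLaguerreFunctional_momentFunctional q y,
    fun ℒ hℒ => hℒ.eq_momentFunctional⟩, fun k n _ => ?_⟩
  have hlin : ∀ 𝓛 : R[X] →ₗ[R] R, QLaguerre.IsLaguerreFunctional q y 𝓛 →
      𝓛 (∏ s, QLaguerre.qLaguerre q y (n s)) =
        ∑ σ : Equiv.Perm (Fin (∑ s, n s)) with QLaguerre.IsDerangement n σ,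
          y ^ QLaguerre.wex σ * q ^ QLaguerre.cr σ := by
    intro ℒ hℒ
    rw [hℒ.eq_momentFunctional, ← QLaguerre.momentFunctional_prod]
    simp only [QLaguerre.matchPoly_eq_qLaguerre]
  refine ⟨hlin, fun m => m.wt_add_cross_nonneg, fun ℒ hℒ => ?_, fun m => m.phi_phi,
    fun m => m.phi_eq_self_iff, fun m hm => ⟨QLaguerre.MarkedPM.exists_convertible_phi hm,
      QLaguerre.MarkedPM.neg_one_pow_numEdges_phi hm⟩, fun m => ⟨m.bwex_phi, m.wt_add_cross_phi⟩⟩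
  rw [hlin ℒ hℒ, ← QLaguerre.MarkedPM.sum_derangements_eq]
  rfl
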